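/- Let $q\in\mathbb{C}$ with $0<|q|<1$. Write $(x;q)_n=\prod_{i=0}^{n-1}(1-q^ix)$ and $(x;q)_\infty=\prod_{i\ge 0}(1-q^ix)$, and for $x,z\ne 0$ put $$j(x;q):=(x;q)_\infty(q/x;q)_\infty(q;q)_\infty,\qquad m(x,z;q):=\frac{1}{j(z;q)}\sum_{r=-\infty}^{\infty}\frac{(-1)^rq^{\binom r2}z^r}{1-q^{r-1}xz}$$ (the latter whenever no denominator vanishes). For integers $a,m$ with $m$ positive put $J_{a,m}:=j(q^a;q^m)$, $J_m:=J_{m,3m}=\prod_{i\ge1}(1-q^{mi})$ and $\overline J_{a,m}:=j(-q^a;q^m)$. Let $g(n)$ be the coefficients of the power series expansion at $q=0$ of the eighth order mock theta function $$V_0(q)=\sum_{n=0}^\infty g(n)q^n:=-1+2\sum_{n\ge0}\frac{q^{n^2}(-q;q^2)_n}{(q;q^2)_n}.$$ **Theorem 1.1.** For all $q$ with $0<|q|<1$ the following series converge and \begin{align*} \sum_{n=0}^{\infty}g(8n)q^{n}&=\frac{1}{J_{1}^3}\overline{J}_{1,4}\left(\overline{J}_{1,2}^2\overline{J}_{2,4}+q\overline{J}_{0,2}^2\overline{J}_{0,4}\right),\\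 \sum_{n=0}^{\infty}g(8n+1)q^{n}&=\frac{2}{J_{1}^3}\overline{J}_{1,2}^3\overline{J}_{2,8},\\ \sum_{n=0}^{\infty}g(8n+2)q^{n}&=\frac{4}{J_{1}^3}\overline{J}_{1,4}\overline{J}_{1,2}\overline{J}_{2,8}\overline{J}_{2,4},\\ \sum_{n=0}^{\infty}g(8n+3)q^{n}&=\frac{4}{J_{1}^3}\overline{J}_{1,2}^2\overline{J}_{2,8}^2,\\ \sum_{n=0}^{\infty}g(8n+4)q^{n}&=\frac{1}{J_{1}^3}\overline{J}_{1,4}\left(\overline{J}_{1,2}^2\overline{J}_{0,4}+\overline{J}_{0,2}^2\overline{J}_{2,4}\right),\\ \sum_{n=0}^{\infty}g(8n+5)q^{n}&=\frac{8}{J_{1}^3}\overline{J}_{2,4}\overline{J}_{1,2}\overline{J}_{2,8}\overline{J}_{4,16},\\ \sum_{n=0}^{\infty}g(8n+6)q^{n}&=\frac{8}{J_{1}^3}\overline{J}_{1,4}\overline{J}_{1,2}\overline{J}_{2,8}\overline{J}_{4,16},\\ \sum_{n=0}^{\infty}g(8n+7)q^{n}&=-2q^{-1}m(1,-1;q)+\frac12\frac{q^{-1}}{J_1^3}\left(\overline{J}_{1,2}^2\overline{J}_{2,4}^2+q\overline{J}_{0,4}\left(2\overline{J}_{2,4}\overline{J}_{0,2}^2+\overline{J}_{1,2}^2\overline{J}_{0,4}\right)\right).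 \end{align*} -/

import Mathlib

noncomputable section

namespace MockV0

/-- The finite `q`-Pochhammer symbol `(x; q)_n = ∏_{i=0}^{n-1} (1 - q^i x)`. -/
def qPoch (x q : ℂ) (n : ℕ) : ℂ := ∏ i ∈ Finset.range n, (1 - q ^ i * x)

/-- The infinite `q`-Pochhammer symbol `(x; q)_∞ = ∏_{i≥0} (1 - q^i x)`, for `|q| < 1`. -/
def qPochInf (x q : ℂ) : ℂ := ∏' i : ℕ, (1 - q ^ i * x)

/-- The theta function `j(x; q) = (x; q)_∞ (q/x; q)_∞ (q; q)_∞`, for `x ≠ 0` and `0 < |q| < 1`. -/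
def j (x q : ℂ) : ℂ := qPochInf x q * qPochInf (q / x) q * qPochInf q q

/-- `J_{a,m} = j(q^a; q^m)` as a function of the nome `q`. -/
def J2 (a : ℤ) (m : ℕ) (q : ℂ) : ℂ := j (q ^ a) (q ^ m)

/-- `J_m = J_{m,3m}` as a function of the nome `q`. -/
def J (m : ℕ) (q : ℂ) : ℂ := J2 m (3 * m) q

/-- `\bar J_{a,m} = j(-q^a; q^m)` as a function of the nome `q`. -/
def Jbar (a : ℤ) (m : ℕ) (q : ℂ) : ℂ := j (-q ^ a) (q ^ m)

/-- The Appell function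
`m(x, z; q) = (1 / j(z; q)) ∑_{r ∈ ℤ} (-1)^r q^{r(r-1)/2} z^r / (1 - q^{r-1} x z)`.
The integer division in the exponent is exact. -/
def appell (x z q : ℂ) : ℂ :=
  1 / j z q *
    ∑' r : ℤ, (-1 : ℂ) ^ r * q ^ (r * (r - 1) / 2) * z ^ r / (1 - q ^ (r - 1) * x * z)

/-- The eighth order mock theta function
`V_0(q) = -1 + 2 ∑_{n≥0} q^{n^2} (-q; q^2)_n / (q; q^2)_n`, on the unit disc. -/
def V0 (q : ℂ) : ℂ :=
  -1 + 2 * ∑' n : ℕ, q ^ (n ^ 2) * qPoch (-q) (q ^ 2) n / qPoch q (q ^ 2) n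

/-- The coefficients `g(n)` in `V_0(q) = ∑_{n≥0} g(n) q^n`: the Taylor coefficients at `0`. -/
def g (n : ℕ) : ℂ := iteratedDeriv n V0 0 / (Nat.factorial n : ℂ)

end MockV0

end

/-!
Write `φ(q) = ∑_{n ∈ ℤ} q^{n²}`, `ψ(q) = ∑_{n ≥ 0} q^{n(n+1)/2}` and `E(q) = (q; q)_∞`. All the
theta functions in the statement are values of `φ` and `ψ`, and the eight identities are the
components of the single formula `euler_mul_V0`,

`E(q⁸)³ V₀(q) = ψ(q²)⁴ + q⁻¹ (φ(q²)² φ(q⁴)² / 2 - 2 E(q⁸)³ m(1, -1; q⁸))`.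

The Appell function occurs here through `q⁸` only, hence contributes to the residue class `7` alone,
and the theta functions are split by `φ(q) = φ(q⁴) + 2qψ(q⁸)`, `φ(q)² = φ(q²)² + 4qψ(q⁴)²` and
`ψ(q)² = φ(q)ψ(q²)` (`phi_two_dissection`, `phi_sq`, `psi_sq`). This gives `V0_dissection`, from
which averaging over the eighth roots of unity extracts the coefficients (`hasSum_section`).

The formula itself is reached in two stages.

* *From a `q`-hypergeometric series to an Appell-Lerch series* (`V0_mul_j`). The deformation
  `∑ xⁿ q^{n²} (-q; q²)_n / (xq; q²)_n` satisfies a first-order recurrence under `x ↦ q⁴x`;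
  iterating it from `x = 1` produces a series with denominators `(q; q⁴)_{n+1} (q³; q⁴)_n`. Each of
  these is expanded in partial fractions, and after exchanging the sums the inner one is evaluated
  by a conjugate Bailey pair.
* *Evaluation of the Appell-Lerch series* (`appellSum_change`, `oddAppellSum_eq`). Splitting
  `(1 + u) / (1 - u)`, where `u = q⁴ʳ⁺¹`, into its even and odd parts gives a combination of series
  that is odd under `y ↦ y⁻¹`, and a multiple of `m(1, q²; q⁸)`. The former, and the difference of
  `m(1, z; Q)` and `m(1, -1; Q)`, are theta quotients: after division by a theta function, at whose
  zeros it vanishes too, each has poles at most at the powers of `Q`, and changes sign under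
  `z ↦ Qz`. So does `j(-z; Q) / j(z; Q)`, and a multiple of it has the same residues; the difference
  is then zero by `eventually_eq_zero_of_antiperiodic`, a form of Liouville's theorem.
-/

open Filter Topology

namespace MockV0

/-! ### `q`-Pochhammer symbols -/

theorem qPoch_succ (x q : ℂ) (n : ℕ) : qPoch x q (n + 1) = qPoch x q n * (1 - q ^ n * x) :=
  Finset.prod_range_succ _ _

theorem qPoch_zero (x q : ℂ) : qPoch x q 0 = 1 := Finset.prod_range_zero _

theorem qPoch_succ' (x q : ℂ) (n : ℕ) : qPoch x q (n + 1) = (1 - x) * qPoch (q * x) q n := by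
  rw [qPoch, Finset.prod_range_succ', mul_comm]
  simp [qPoch, pow_succ, mul_assoc]

theorem summable_norm_pow_mul {q : ℂ} (hq : ‖q‖ < 1) (x : ℂ) :
    Summable fun i : ℕ => ‖-(q ^ i * x)‖ := by
  simpa [norm_mul, norm_pow] using
    (summable_geometric_of_lt_one (norm_nonneg q) hq).mul_right ‖x‖

theorem multipliable_qPochInf {q : ℂ} (hq : ‖q‖ < 1) (x : ℂ) :
    Multipliable fun i : ℕ => 1 - q ^ i * x := by
  simpa [sub_eq_add_neg] using multipliable_one_add_of_summable (summable_norm_pow_mul hq x)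

theorem tendsto_qPoch {q : ℂ} (hq : ‖q‖ < 1) (x : ℂ) :
    Tendsto (qPoch x q) atTop (𝓝 (qPochInf x q)) :=
  (multipliable_qPochInf hq x).hasProd.tendsto_prod_nat

theorem qPochInf_eq {q : ℂ} (hq : ‖q‖ < 1) (x : ℂ) :
    qPochInf x q = (1 - x) * qPochInf (q * x) q :=
  tendsto_nhds_unique ((tendsto_add_atTop_iff_nat 1).2 (tendsto_qPoch hq x))
    (by simpa only [qPoch_succ'] using (tendsto_qPoch hq (q * x)).const_mul (1 - x))

theorem qPochInf_ne_zero {q : ℂ} (hq : ‖q‖ < 1) {x : ℂ} (hx : ∀ i : ℕ, q ^ i * x ≠ 1) :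
    qPochInf x q ≠ 0 := by
  have := tprod_one_add_ne_zero_of_summable (f := fun i : ℕ => -(q ^ i * x))
    (fun i h => hx i (by linear_combination -h)) (summable_norm_pow_mul hq x)
  simpa [qPochInf, sub_eq_add_neg] using this

theorem pow_mul_ne_one {q x : ℂ} (hq : ‖q‖ < 1) (hx : ‖x‖ < 1) (i : ℕ) : q ^ i * x ≠ 1 := by
  intro h
  have h1 : ‖q ^ i * x‖ < 1 := by
    rw [norm_mul, norm_pow]
    calc ‖q‖ ^ i * ‖x‖ ≤ 1 * ‖x‖ := by
          gcongr
          exact pow_le_one₀ (norm_nonneg _) hq.le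
      _ < 1 := by simpa using hx
  rw [h] at h1
  simp at h1

theorem qPochInf_ne_zero_of_norm_lt {q x : ℂ} (hq : ‖q‖ < 1) (hx : ‖x‖ < 1) :
    qPochInf x q ≠ 0 :=
  qPochInf_ne_zero hq fun i => pow_mul_ne_one hq hx i

theorem qPoch_ne_zero {q x : ℂ} (hx : ∀ i : ℕ, q ^ i * x ≠ 1) (n : ℕ) : qPoch x q n ≠ 0 :=
  Finset.prod_ne_zero_iff.2 fun i _ h => hx i (by linear_combination -h)

theorem qPoch_ne_zero_of_norm_lt {q x : ℂ} (hq : ‖q‖ < 1) (hx : ‖x‖ < 1) (n : ℕ) :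
    qPoch x q n ≠ 0 :=
  qPoch_ne_zero (fun i => pow_mul_ne_one hq hx i) n

theorem differentiable_qPochInf {q : ℂ} (hq : ‖q‖ < 1) :
    Differentiable ℂ fun x => qPochInf x q := by
  rw [← differentiableOn_univ]
  have h : HasProdLocallyUniformlyOn (fun (i : ℕ) (x : ℂ) => 1 + -(q ^ i * x))
      (fun x => ∏' i : ℕ, (1 + -(q ^ i * x))) Set.univ := by
    apply hasProdLocallyUniformlyOn_of_forall_compact isOpen_univ
    intro K _ hK
    obtain ⟨C, hC⟩ := hK.isBounded.exists_norm_le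
    refine ((summable_geometric_of_lt_one (norm_nonneg q) hq).mul_right
      C).hasProdUniformlyOn_nat_one_add hK (.of_forall fun n x hx ↦ ?_) (fun _ ↦ by fun_prop)
    rw [norm_neg, norm_mul, norm_pow]
    gcongr
    exact hC x hx
  have h2 := h.differentiableOn (.of_forall fun s ↦ by
    simpa [Finset.prod_fn] using! DifferentiableOn.finsetProd (u := s) (s := Set.univ)
      (f := fun (i : ℕ) (x : ℂ) => 1 + -(q ^ i * x)) (fun _ _ ↦ by fun_prop)) isOpen_univ
  simpa [qPochInf, sub_eq_add_neg] using h2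

theorem qPoch_two_mul (x q : ℂ) (n : ℕ) :
    qPoch x q (2 * n) = qPoch x (q ^ 2) n * qPoch (q * x) (q ^ 2) n := by
  induction n with
  | zero => simp [qPoch_zero]
  | succ n ih =>
    rw [show 2 * (n + 1) = 2 * n + 1 + 1 by ring, qPoch_succ, qPoch_succ, ih, qPoch_succ,
      qPoch_succ]
    ring

theorem norm_pow_lt_one {q : ℂ} (hq : ‖q‖ < 1) {n : ℕ} (hn : n ≠ 0) : ‖q ^ n‖ < 1 := by
  rw [norm_pow]
  exact pow_lt_one₀ (norm_nonneg _) hq hn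

theorem qPochInf_split {q : ℂ} (hq : ‖q‖ < 1) (x : ℂ) :
    qPochInf x q = qPochInf x (q ^ 2) * qPochInf (q * x) (q ^ 2) := by
  have h2 := norm_pow_lt_one hq two_ne_zero
  refine tendsto_nhds_unique
    ((tendsto_qPoch hq x).comp (tendsto_id.const_mul_atTop' (r := 2) two_pos)) ?_
  simpa only [Function.comp_def, id, qPoch_two_mul] using
    (tendsto_qPoch h2 x).mul (tendsto_qPoch h2 (q * x))

theorem qPochInf_mul_neg {q : ℂ} (hq : ‖q‖ < 1) (x : ℂ) :
    qPochInf x q * qPochInf (-x) q = qPochInf (x ^ 2) (q ^ 2) := by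
  have h2 := norm_pow_lt_one hq two_ne_zero
  refine tendsto_nhds_unique ((tendsto_qPoch hq x).mul (tendsto_qPoch hq (-x))) ?_
  convert tendsto_qPoch h2 (x ^ 2) using 2 with n
  simp only [qPoch, ← Finset.prod_mul_distrib]
  refine Finset.prod_congr rfl fun i _ => ?_
  ring

/-- The reciprocal `1 / (q; q)_m`, extended by zero to negative `m`; with this convention
`invPoch_eq` holds for every integer `m`, so that sums over `r` need no explicit bounds. -/
noncomputable def invPoch (q : ℂ) (m : ℤ) : ℂ := if 0 ≤ m then (qPoch q q m.toNat)⁻¹ else 0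

theorem invPoch_of_neg (q : ℂ) {m : ℤ} (hm : m < 0) : invPoch q m = 0 := by
  simp [invPoch, not_le.2 hm]

theorem invPoch_natCast (q : ℂ) (n : ℕ) : invPoch q n = (qPoch q q n)⁻¹ := by
  simp [invPoch]

theorem invPoch_zero (q : ℂ) : invPoch q 0 = 1 := by
  simpa [qPoch_zero] using invPoch_natCast q 0

theorem invPoch_eq {q : ℂ} (hq : ‖q‖ < 1) (m : ℤ) :
    invPoch q m = (1 - q ^ (m + 1)) * invPoch q (m + 1) := by
  rcases lt_trichotomy m (-1) with h | rfl | h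
  · rw [invPoch_of_neg q (by omega), invPoch_of_neg q (by omega), mul_zero]
  · rw [invPoch_of_neg q (by omega)]
    simp
  · lift m to ℕ using by omega
    have h1 := qPoch_ne_zero_of_norm_lt hq hq (m + 1)
    have h0 := qPoch_ne_zero_of_norm_lt hq hq m
    have h2 := invPoch_natCast q (m + 1)
    push_cast at h2
    rw [h2, invPoch_natCast]
    rw [qPoch_succ] at h1 ⊢
    have h3 : (q : ℂ) ^ ((m : ℤ) + 1) = q ^ m * q := by
      rw [show ((m : ℤ) + 1) = ((m + 1 : ℕ) : ℤ) by push_cast; ring, zpow_natCast, pow_succ]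
    rw [h3]
    have h4 := right_ne_zero_of_mul h1
    field_simp

theorem tendsto_invPoch {q : ℂ} (hq : ‖q‖ < 1) :
    Tendsto (invPoch q) atTop (𝓝 (qPochInf q q)⁻¹) := by
  rw [← Nat.map_cast_int_atTop, tendsto_map'_iff]
  simpa only [Function.comp_def, invPoch_natCast] using
    (tendsto_qPoch hq q).inv₀ (qPochInf_ne_zero_of_norm_lt hq hq)

theorem exists_norm_invPoch_le {q : ℂ} (hq : ‖q‖ < 1) :
    ∃ K : ℝ, 0 ≤ K ∧ ∀ m, ‖invPoch q m‖ ≤ K := by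
  obtain ⟨K, hK⟩ := ((tendsto_qPoch hq q).inv₀
    (qPochInf_ne_zero_of_norm_lt hq hq)).norm.bddAbove_range
  have hK' : ∀ n : ℕ, ‖(qPoch q q n)⁻¹‖ ≤ K := fun n => hK ⟨n, rfl⟩
  refine ⟨K, (norm_nonneg _).trans (hK' 0), fun m => ?_⟩
  rcases lt_or_ge m 0 with h | h
  · rw [invPoch_of_neg q h, norm_zero]
    exact (norm_nonneg _).trans (hK' 0)
  · lift m to ℕ using h
    rw [invPoch_natCast]
    exact hK' m

/-! ### The Jacobi triple product -/

theorem tri_succ (r : ℤ) : (r + 1) * (r + 1 - 1) / 2 = r * (r - 1) / 2 + r := by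
  have : (r + 1) * (r + 1 - 1) = r * (r - 1) + r * 2 := by ring
  rw [this, Int.add_mul_ediv_right _ _ two_ne_zero]

theorem tri_neg (r : ℤ) : -r * (-r - 1) / 2 = r * (r - 1) / 2 + r := by
  rw [← tri_succ]
  ring_nf

theorem two_mul_tri (r : ℤ) : 2 * (r * (r - 1) / 2) = r * (r - 1) :=
  Int.mul_ediv_cancel' (even_iff_two_dvd.1 (by simpa using Int.even_mul_pred_self r))

/-- The general term `(-1)^r q^{r(r-1)/2} z^r` of the bilateral theta series. -/
noncomputable def thetaTerm (q z : ℂ) (r : ℤ) : ℂ := (-1) ^ r * q ^ (r * (r - 1) / 2) * z ^ r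

theorem thetaTerm_succ {q z : ℂ} (hq : q ≠ 0) (hz : z ≠ 0) (r : ℤ) :
    thetaTerm q z (r + 1) = -z * q ^ r * thetaTerm q z r := by
  rw [thetaTerm, thetaTerm, tri_succ, zpow_add₀ hq, zpow_add_one₀ hz, zpow_add_one₀ (by simp)]
  ring

theorem thetaTerm_neg {q z : ℂ} (hq : q ≠ 0) (r : ℤ) :
    thetaTerm q z (-r) = thetaTerm q (q / z) r := by
  rw [thetaTerm, thetaTerm, tri_neg, zpow_add₀ hq, div_zpow, zpow_neg, zpow_neg, ← inv_zpow]
  norm_num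
  ring

theorem thetaTerm_mul (q z w : ℂ) (r : ℤ) :
    thetaTerm q (w * z) r = w ^ r * thetaTerm q z r := by
  rw [thetaTerm, thetaTerm, mul_zpow]
  ring

theorem summable_norm_thetaTerm_nat {q : ℂ} (hq0 : q ≠ 0) (hq : ‖q‖ < 1) {z : ℂ} (hz : z ≠ 0) :
    Summable fun n : ℕ => ‖thetaTerm q z n‖ := by
  have hne : ∀ n : ℕ, thetaTerm q z n ≠ 0 := fun n => by
    exact mul_ne_zero (mul_ne_zero (zpow_ne_zero _ (by simp)) (zpow_ne_zero _ hq0))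
      (zpow_ne_zero _ hz)
  refine (summable_of_ratio_test_tendsto_lt_one (l := 0) one_pos (.of_forall hne) ?_).norm
  have h : ∀ n : ℕ, ‖thetaTerm q z ((n + 1 : ℕ) : ℤ)‖ / ‖thetaTerm q z n‖ = ‖z‖ * ‖q‖ ^ n := by
    intro n
    push_cast
    rw [thetaTerm_succ hq0 hz, norm_mul, mul_div_cancel_right₀ _ (norm_ne_zero_iff.2 (hne n))]
    simp
  simp only [h]
  simpa using (tendsto_pow_atTop_nhds_zero_of_lt_one (norm_nonneg q) hq).const_mul ‖z‖

theorem summable_norm_thetaTerm {q : ℂ} (hq0 : q ≠ 0) (hq : ‖q‖ < 1) {z : ℂ} (hz : z ≠ 0) :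
    Summable fun r : ℤ => ‖thetaTerm q z r‖ := by
  refine Summable.of_nat_of_neg (summable_norm_thetaTerm_nat hq0 hq hz) ?_
  simp only [thetaTerm_neg hq0]
  exact summable_norm_thetaTerm_nat hq0 hq (div_ne_zero hq0 hz)

/-- A Laurent polynomial interpolating between `1` and the theta series; see
`qBinomialSum_mul`. -/
noncomputable def qBinomialSum (q z : ℂ) (M N : ℤ) : ℂ :=
  ∑' r : ℤ, thetaTerm q z r * (invPoch q (M - r) * invPoch q (N + r))

theorem summable_of_invPoch_mul (q : ℂ) (f : ℤ → ℂ) (M N : ℤ) :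
    Summable fun r : ℤ => f r * (invPoch q (M - r) * invPoch q (N + r)) := by
  refine summable_of_ne_finset_zero (s := Finset.Icc (-N) M) fun r hr => ?_
  rw [Finset.mem_Icc, not_and_or] at hr
  rcases hr with h | h
  · rw [invPoch_of_neg q (show N + r < 0 by omega)]
    simp
  · rw [invPoch_of_neg q (show M - r < 0 by omega)]
    simp

theorem qBinomialSum_step {q z : ℂ} (hq0 : q ≠ 0) (hq : ‖q‖ < 1) (hz : z ≠ 0) (M N : ℤ) :
    (1 - q ^ (M + 1 + N)) * qBinomialSum q z (M + 1) N
      = (1 - z * q ^ M) * qBinomialSum q z M N := by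
  have h1 : ∀ r, (1 - q ^ (M + 1 + N)) *
      (thetaTerm q z r * (invPoch q (M + 1 - r) * invPoch q (N + r)))
      = thetaTerm q z r * (invPoch q (M - r) * invPoch q (N + r))
        + (q ^ (M + 1 - r) * thetaTerm q z r) *
          (invPoch q (M + 1 - r) * invPoch q (N - 1 + r)) := by
    intro r
    have e1 := invPoch_eq hq (M - r)
    have e2 := invPoch_eq hq (N - 1 + r)
    rw [show M - r + 1 = M + 1 - r by ring] at e1
    rw [show N - 1 + r + 1 = N + r by ring] at e2
    have e3 : q ^ (M + 1 + N) = q ^ (M + 1 - r) * q ^ (N + r) := by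
      rw [← zpow_add₀ hq0]
      ring_nf
    rw [e1, e2, e3]
    ring
  have h2 : ∀ r, (q ^ (M + 1 - (r + 1)) * thetaTerm q z (r + 1)) *
      (invPoch q (M + 1 - (r + 1)) * invPoch q (N - 1 + (r + 1)))
      = -(z * q ^ M) * (thetaTerm q z r * (invPoch q (M - r) * invPoch q (N + r))) := by
    intro r
    rw [thetaTerm_succ hq0 hz, show M + 1 - (r + 1) = M - r by ring,
      show N - 1 + (r + 1) = N + r by ring, zpow_sub₀ hq0]
    have := zpow_ne_zero r hq0
    field_simp
  rw [qBinomialSum, ← tsum_mul_left, tsum_congr h1, Summable.tsum_add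
    (summable_of_invPoch_mul q _ M N) (summable_of_invPoch_mul q _ (M + 1) (N - 1)),
    ← (Equiv.addRight (1 : ℤ)).tsum_eq (fun r => (q ^ (M + 1 - r) * thetaTerm q z r) *
      (invPoch q (M + 1 - r) * invPoch q (N - 1 + r)))]
  simp only [Equiv.coe_addRight, h2]
  rw [tsum_mul_left, qBinomialSum]
  ring

theorem qBinomialSum_symm {q z : ℂ} (hq0 : q ≠ 0) (M N : ℤ) :
    qBinomialSum q z M N = qBinomialSum q (q / z) N M := by
  rw [qBinomialSum, ← (Equiv.neg ℤ).tsum_eq]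
  refine tsum_congr fun r => ?_
  rw [Equiv.neg_apply, thetaTerm_neg hq0, sub_neg_eq_add, ← sub_eq_add_neg,
    mul_comm (invPoch q (M + r))]

theorem qBinomialSum_zero_zero (q z : ℂ) : qBinomialSum q z 0 0 = 1 := by
  rw [qBinomialSum, tsum_eq_single 0]
  · simp [thetaTerm, invPoch_zero]
  · intro r hr
    rcases lt_or_gt_of_ne hr with h | h
    · rw [invPoch_of_neg q (show 0 + r < 0 by omega)]
      simp
    · rw [invPoch_of_neg q (show 0 - r < 0 by omega)]
      simp

theorem qBinomialSum_mul_left {q z : ℂ} (hq0 : q ≠ 0) (hq : ‖q‖ < 1) (hz : z ≠ 0) (M N : ℕ) :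
    qPoch q q (M + N) * qBinomialSum q z M N
      = qPoch z q M * (qPoch q q N * qBinomialSum q z 0 N) := by
  induction M with
  | zero => simp [qPoch_zero]
  | succ M ih =>
    have h := qBinomialSum_step hq0 hq hz M N
    have h3 : (q : ℂ) ^ ((M : ℤ) + 1 + N) = q ^ (M + N) * q := by
      rw [show ((M : ℤ) + 1 + N) = ((M + N + 1 : ℕ) : ℤ) by push_cast; ring, zpow_natCast,
        pow_succ]
    rw [h3, zpow_natCast] at h
    rw [show M + 1 + N = M + N + 1 by ring, qPoch_succ, qPoch_succ]
    push_cast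
    linear_combination qPoch q q (M + N) * h + (1 - q ^ M * z) * ih

/-- The finite form of the triple product (the `q`-binomial theorem). -/
theorem qBinomialSum_mul {q z : ℂ} (hq0 : q ≠ 0) (hq : ‖q‖ < 1) (hz : z ≠ 0) (M N : ℕ) :
    qPoch q q (M + N) * qBinomialSum q z M N = qPoch z q M * qPoch (q / z) q N := by
  have h := qBinomialSum_mul_left hq0 hq (div_ne_zero hq0 hz) N 0
  rw [← Nat.cast_zero (R := ℤ)] at *
  rw [qBinomialSum_mul_left hq0 hq hz, ← Nat.cast_zero (R := ℤ), qBinomialSum_symm hq0]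
  simp only [qPoch_zero, add_zero, Nat.cast_zero, qBinomialSum_zero_zero] at h ⊢
  rw [h]
  ring

/-- The Jacobi triple product identity. -/
theorem hasSum_j {q z : ℂ} (hq0 : q ≠ 0) (hq : ‖q‖ < 1) (hz : z ≠ 0) :
    HasSum (thetaTerm q z) (j z q) := by
  have hs := summable_norm_thetaTerm hq0 hq hz
  obtain ⟨K, hK0, hK⟩ := exists_norm_invPoch_le hq
  have hne := qPochInf_ne_zero_of_norm_lt hq hq
  have hZ : Tendsto (fun N : ℕ => (N : ℤ)) atTop atTop := tendsto_natCast_atTop_atTop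
  have hlim : Tendsto (fun N : ℕ => qBinomialSum q z N N) atTop
      (𝓝 (∑' r, thetaTerm q z r * ((qPochInf q q)⁻¹ * (qPochInf q q)⁻¹))) := by
    refine tendsto_tsum_of_dominated_convergence (bound := fun r => ‖thetaTerm q z r‖ * (K * K))
      (hs.mul_right _) (fun r => ?_) (.of_forall fun N r => ?_)
    · refine Tendsto.const_mul _ (Tendsto.mul ?_ ?_)
      · exact (tendsto_invPoch hq).comp (tendsto_atTop_add_const_right _ (-r) hZ)
      · exact (tendsto_invPoch hq).comp (tendsto_atTop_add_const_right _ r hZ)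
    · rw [norm_mul, norm_mul]
      gcongr <;> exact hK _
  have hlim2 := ((tendsto_qPoch hq q).comp (tendsto_id.const_mul_atTop' (r := 2) two_pos)).mul hlim
  have hlim3 := (tendsto_qPoch hq z).mul (tendsto_qPoch hq (q / z))
  have h := tendsto_nhds_unique (hlim2.congr fun N => ?_) hlim3
  · rw [tsum_mul_right] at h
    have : j z q = ∑' r, thetaTerm q z r := by
      rw [j, ← h]
      field_simp
    rw [this]
    exact hs.of_norm.hasSum
  · simp only [Function.comp, id, two_mul]
    exact qBinomialSum_mul hq0 hq hz N N

/-! ### Theta functions -/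

theorem j_mul_left {q z : ℂ} (hq : ‖q‖ < 1) (hq0 : q ≠ 0) (hz : z ≠ 0) :
    j (q * z) q = -z⁻¹ * j z q := by
  have h1 := qPochInf_eq hq z
  have h2 := qPochInf_eq hq (1 / z)
  rw [show q * (1 / z) = q / z by ring] at h2
  rw [j, j, h1, show q / (q * z) = 1 / z by field_simp, h2]
  field_simp
  ring

theorem j_div_left {q z : ℂ} (hq0 : q ≠ 0) : j (q / z) q = j z q := by
  rw [j, j, div_div_cancel₀ hq0]
  ring

theorem j_ne_zero {q z : ℂ} (hq : ‖q‖ < 1) (hq0 : q ≠ 0) (hz : z ≠ 0)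
    (h : ∀ r : ℤ, q ^ r * z ≠ 1) : j z q ≠ 0 := by
  refine mul_ne_zero (mul_ne_zero ?_ ?_) (qPochInf_ne_zero_of_norm_lt hq hq)
  · exact qPochInf_ne_zero hq fun i => by simpa using h i
  · refine qPochInf_ne_zero hq fun i hi => h (-(i + 1 : ℤ)) ?_
    rw [zpow_neg, inv_mul_eq_one₀ (zpow_ne_zero _ hq0), zpow_add_one₀ hq0, zpow_natCast]
    field_simp at hi
    exact hi

theorem zpow_mul_ne_one {q z : ℂ} (hq : ‖q‖ < 1) (hq0 : q ≠ 0) (h1 : ‖q‖ < ‖z‖) (h2 : ‖z‖ ≤ 1)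
    (h3 : z ≠ 1) (r : ℤ) : q ^ r * z ≠ 1 := by
  intro h
  have hn : ‖q‖ ^ r * ‖z‖ = 1 := by rw [← norm_zpow, ← norm_mul, h, norm_one]
  have hqp : 0 < ‖q‖ := norm_pos_iff.2 hq0
  rcases lt_trichotomy r 0 with hr | rfl | hr
  · have : ‖q‖ ^ (-1 : ℤ) ≤ ‖q‖ ^ r := zpow_le_zpow_right_of_le_one₀ hqp hq.le (by omega)
    have h4 : ‖q‖ ^ (-1 : ℤ) * ‖z‖ ≤ 1 := by
      rw [← hn]
      gcongr
    rw [zpow_neg_one, inv_mul_le_iff₀ hqp] at h4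
    linarith
  · exact h3 (by simpa using h)
  · have : ‖q‖ ^ r ≤ ‖q‖ ^ (1 : ℤ) := zpow_le_zpow_right_of_le_one₀ hqp hq.le (by omega)
    rw [zpow_one] at this
    have : ‖q‖ ^ r * ‖z‖ < 1 := by
      calc ‖q‖ ^ r * ‖z‖ ≤ ‖q‖ * 1 := by gcongr
        _ < 1 := by simpa using hq
    linarith

/-- Ramanujan's theta function `φ(q) = ∑ q^{n²}`, over all integers `n`. -/
noncomputable def phi (q : ℂ) : ℂ := j (-q) (q ^ 2)

/-- Ramanujan's theta function `ψ(q) = ∑ q^{n(n+1)/2}`, over `n ≥ 0`. -/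
noncomputable def psi (q : ℂ) : ℂ := j (-q) (q ^ 4)

/-- Euler's function `(q; q)_∞`. -/
noncomputable def euler (q : ℂ) : ℂ := qPochInf q q

theorem euler_ne_zero {q : ℂ} (hq : ‖q‖ < 1) : euler q ≠ 0 := qPochInf_ne_zero_of_norm_lt hq hq

theorem qPochInf_self_sq {q : ℂ} (hq : ‖q‖ < 1) : qPochInf q (q ^ 2) * euler (q ^ 2) = euler q := by
  rw [euler, euler, qPochInf_split hq q, sq]

theorem qPochInf_neg_self {q : ℂ} (hq : ‖q‖ < 1) : euler q * qPochInf (-q) q = euler (q ^ 2) :=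
  qPochInf_mul_neg hq q

theorem qPochInf_neg_self_sq {q : ℂ} (hq : ‖q‖ < 1) :
    qPochInf (-q) (q ^ 2) * (euler q * euler (q ^ 4)) = euler (q ^ 2) ^ 2 := by
  have h2 := norm_pow_lt_one hq two_ne_zero
  have a := qPochInf_self_sq hq
  have b := qPochInf_mul_neg h2 q
  have c := qPochInf_self_sq h2
  rw [← pow_mul] at b c
  norm_num at b c
  rw [← b] at c
  linear_combination (-qPochInf (-q) (q ^ 2) * euler (q ^ 4)) * a + euler (q ^ 2) * c

theorem phi_mul {q : ℂ} (hq : ‖q‖ < 1) (hq0 : q ≠ 0) :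
    phi q * (euler q * euler (q ^ 4)) ^ 2 = euler (q ^ 2) ^ 5 := by
  have a := qPochInf_neg_self_sq hq
  rw [phi, j, show q ^ 2 / -q = -q by field_simp]
  change _ * euler (q ^ 2) * _ = _
  linear_combination euler (q ^ 2) * (qPochInf (-q) (q ^ 2) * (euler q * euler (q ^ 4)) +
    euler (q ^ 2) ^ 2) * a

theorem phi_neg_mul {q : ℂ} (hq : ‖q‖ < 1) (hq0 : q ≠ 0) :
    phi (-q) * euler (q ^ 2) = euler q ^ 2 := by
  have a := qPochInf_self_sq hq
  rw [phi, neg_sq, neg_neg, j, show q ^ 2 / q = q by field_simp]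
  change _ * euler (q ^ 2) * _ = _
  linear_combination (qPochInf q (q ^ 2) * euler (q ^ 2) + euler q) * a

theorem psi_eq {q : ℂ} (hq : ‖q‖ < 1) (hq0 : q ≠ 0) :
    psi q = qPochInf (-q) (q ^ 2) * euler (q ^ 4) := by
  have h2 := norm_pow_lt_one hq two_ne_zero
  rw [psi, j, qPochInf_split h2 (-q), show q ^ 4 / -q = q ^ 2 * -q by field_simp,
    show (q ^ 2) ^ 2 = q ^ 4 by ring, euler]

theorem psi_mul {q : ℂ} (hq : ‖q‖ < 1) (hq0 : q ≠ 0) : psi q * euler q = euler (q ^ 2) ^ 2 := by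
  rw [psi_eq hq hq0, ← qPochInf_neg_self_sq hq]
  ring

theorem psi_neg_mul {q : ℂ} (hq : ‖q‖ < 1) (hq0 : q ≠ 0) :
    psi (-q) * euler (q ^ 2) = euler q * euler (q ^ 4) := by
  rw [psi_eq (by rwa [norm_neg]) (neg_ne_zero.2 hq0), neg_neg, ← qPochInf_self_sq hq,
    Even.neg_pow (by decide), Even.neg_pow (by decide)]
  ring

theorem j_neg_one {q : ℂ} (hq : ‖q‖ < 1) (hq0 : q ≠ 0) : j (-1) q = 2 * psi q := by
  have a := qPochInf_neg_self hq
  have b := psi_mul hq hq0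
  have c := qPochInf_eq hq (-1)
  have e := euler_ne_zero hq
  refine mul_right_cancel₀ e ?_
  rw [j, c, mul_neg_one, div_neg, div_one, mul_assoc 2, b, ← a]
  change _ * euler q * _ = _
  ring

theorem psi_sq {q : ℂ} (hq : ‖q‖ < 1) (hq0 : q ≠ 0) : psi q ^ 2 = phi q * psi (q ^ 2) := by
  have h2 := norm_pow_lt_one hq two_ne_zero
  have a := psi_mul hq hq0
  have b := psi_mul h2 (pow_ne_zero 2 hq0)
  have c := phi_mul hq hq0
  rw [← pow_mul] at b
  norm_num at b
  have e1 := euler_ne_zero hq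
  have e2 := euler_ne_zero h2
  have e4 := euler_ne_zero (norm_pow_lt_one hq four_ne_zero)
  rw [← eq_div_iff (by positivity)] at a b c
  rw [a, b, c]
  field_simp

theorem phi_mul_phi_neg {q : ℂ} (hq : ‖q‖ < 1) (hq0 : q ≠ 0) :
    phi q * phi (-q) = phi (-q ^ 2) ^ 2 := by
  have h2 := norm_pow_lt_one hq two_ne_zero
  have a := phi_mul hq hq0
  have b := phi_neg_mul hq hq0
  have c := phi_neg_mul h2 (pow_ne_zero 2 hq0)
  rw [← pow_mul] at c
  norm_num at c
  have e1 := euler_ne_zero hq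
  have e2 := euler_ne_zero h2
  have e4 := euler_ne_zero (norm_pow_lt_one hq four_ne_zero)
  rw [← eq_div_iff (by positivity)] at a b c
  rw [a, b, c]
  field_simp

theorem euler_pow_mul_psi {q : ℂ} (hq : ‖q‖ < 1) (hq0 : q ≠ 0) :
    euler (q ^ 4) ^ 3 * psi q = psi (q ^ 4) * psi (-q) * phi q * phi (q ^ 2) := by
  have h2 := norm_pow_lt_one hq two_ne_zero
  have h4 := norm_pow_lt_one hq four_ne_zero
  have a := psi_mul hq hq0
  have b := psi_mul h4 (pow_ne_zero 4 hq0)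
  have c := psi_neg_mul hq hq0
  have d := phi_mul hq hq0
  have f := phi_mul h2 (pow_ne_zero 2 hq0)
  rw [← pow_mul] at b f
  rw [← pow_mul] at f
  norm_num at b f
  have e1 := euler_ne_zero hq
  have e2 := euler_ne_zero h2
  have e4 := euler_ne_zero h4
  have e8 := euler_ne_zero (norm_pow_lt_one hq (n := 8) (by norm_num))
  rw [← eq_div_iff (by positivity)] at a b c d f
  rw [a, b, c, d, f]
  field_simp

theorem hasSum_int_even_add_odd {f : ℤ → ℂ} {a b : ℂ} (he : HasSum (fun r : ℤ => f (2 * r)) a)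
    (ho : HasSum (fun r : ℤ => f (2 * r - 1)) b) : HasSum f (a + b) := by
  have h2 : Function.Injective fun r : ℤ => 2 * r := fun a b h => by simpa using h
  have h3 : Function.Injective fun r : ℤ => 2 * r - 1 := fun a b h => by simpa using h
  have e2 : (Set.range fun r : ℤ => 2 * r) = {n | Even n} := by
    ext x
    simp [even_iff_exists_two_mul]
  have e3 : (Set.range fun r : ℤ => 2 * r - 1) = {n | Odd n} := by
    ext x
    constructor
    · rintro ⟨r, rfl⟩
      exact ⟨r - 1, by ring⟩
    · rintro ⟨r, rfl⟩
      exact ⟨r + 1, by ring⟩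
  exact (h2.hasSum_range_iff.2 he).add_isCompl (e2 ▸ e3 ▸ Int.isCompl_even_odd)
    (h3.hasSum_range_iff.2 ho)

theorem hasSum_phi {q : ℂ} (hq : ‖q‖ < 1) (hq0 : q ≠ 0) :
    HasSum (fun r : ℤ => q ^ (r ^ 2)) (phi q) := by
  refine (hasSum_j (pow_ne_zero 2 hq0) (norm_pow_lt_one hq two_ne_zero)
    (neg_ne_zero.2 hq0)).congr_fun fun r => ?_
  rw [thetaTerm, ← zpow_natCast, ← zpow_mul, neg_eq_neg_one_mul q, mul_zpow]
  push_cast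
  rw [two_mul_tri, show r ^ 2 = r * (r - 1) + r by ring, zpow_add₀ hq0]
  have : (-1 : ℂ) ^ r * (-1) ^ r = 1 := by rw [← mul_zpow]; norm_num
  linear_combination -(q ^ (r * (r - 1)) * q ^ r) * this

theorem phi_two_dissection {q : ℂ} (hq : ‖q‖ < 1) (hq0 : q ≠ 0) :
    phi q = phi (q ^ 4) + 2 * q * psi (q ^ 8) := by
  have h8 := norm_pow_lt_one hq (n := 8) (by norm_num)
  have h80 := pow_ne_zero 8 hq0
  refine (hasSum_phi hq hq0).unique (hasSum_int_even_add_odd ?_ ?_)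
  · refine (hasSum_phi (norm_pow_lt_one hq four_ne_zero) (pow_ne_zero 4 hq0)).congr_fun
      fun r => ?_
    rw [← zpow_natCast, ← zpow_mul]
    congr 1
    push_cast
    ring
  · have h := (hasSum_j h80 h8 (neg_ne_zero.2 one_ne_zero)).mul_left q
    rw [j_neg_one h8 h80] at h
    convert! h using 1
    · ext r
      rw [thetaTerm, ← zpow_natCast, ← zpow_mul]
      have : (-1 : ℂ) ^ r * (-1) ^ r = 1 := by rw [← mul_zpow]; norm_num
      have h2 : (2 * r - 1) ^ 2 = ((8 : ℕ) : ℤ) * (r * (r - 1) / 2) + 1 := by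
        push_cast
        linear_combination (-4) * two_mul_tri r
      rw [h2, zpow_add_one₀ hq0]
      linear_combination -(q * q ^ (((8 : ℕ) : ℤ) * (r * (r - 1) / 2))) * this
    · ring

/-- Splitting `φ(±w)` by `phi_two_dissection` in `φ(w) φ(-w) = φ(-w²)²` gives the identity for
`q = -w²`. -/
theorem phi_sq {q : ℂ} (hq : ‖q‖ < 1) (hq0 : q ≠ 0) :
    phi q ^ 2 = phi (q ^ 2) ^ 2 + 4 * q * psi (q ^ 4) ^ 2 := by
  obtain ⟨w, hw⟩ : ∃ w, w ^ 2 = -q := IsAlgClosed.exists_pow_nat_eq _ two_pos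
  obtain rfl : q = -w ^ 2 := by rw [hw, neg_neg]
  have hw0 : w ≠ 0 := by
    rintro rfl
    simp at hq0
  have hw1 : ‖w‖ < 1 := by
    rw [norm_neg, norm_pow] at hq
    exact lt_of_pow_lt_pow_left₀ 2 zero_le_one (by simpa using hq)
  have a := phi_mul_phi_neg hw1 hw0
  have b := phi_two_dissection hw1 hw0
  have c := phi_two_dissection (q := -w) (by rwa [norm_neg]) (neg_ne_zero.2 hw0)
  rw [Even.neg_pow (by decide), Even.neg_pow (by decide)] at c
  rw [← a, b, c, show (-w ^ 2) ^ 2 = w ^ 4 by ring, show (-w ^ 2) ^ 4 = w ^ 8 by ring]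
  ring

/-! ### Uniform bounds -/

/-- Finite `q`-Pochhammer symbols and their reciprocals are bounded, uniformly in the base and the
argument on closed discs inside the unit disc. -/
theorem exists_norm_qPoch_le {ρ σ : ℝ} (hρ0 : 0 ≤ ρ) (hρ : ρ < 1) (hσ0 : 0 ≤ σ) (hσ : σ < 1) :
    ∃ C : ℝ, 0 ≤ C ∧ ∀ q y : ℂ, ‖q‖ ≤ σ → ‖y‖ ≤ ρ → ∀ n,
      ‖qPoch y q n‖ ≤ C ∧ ‖(qPoch y q n)⁻¹‖ ≤ C := by
  have hσ' : ‖(σ : ℂ)‖ < 1 := by simpa [abs_of_nonneg hσ0] using hσ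
  have hρ' : ‖(ρ : ℂ)‖ < 1 := by simpa [abs_of_nonneg hρ0] using hρ
  obtain ⟨A, hA⟩ := (tendsto_qPoch hσ' (-ρ : ℂ)).norm.bddAbove_range
  obtain ⟨B, hB⟩ := ((tendsto_qPoch hσ' (ρ : ℂ)).inv₀
    (qPochInf_ne_zero_of_norm_lt hσ' hρ')).norm.bddAbove_range
  have hA' : ∀ n, ‖qPoch (-ρ : ℂ) σ n‖ ≤ A := fun n => hA ⟨n, rfl⟩
  have hB' : ∀ n, ‖(qPoch (ρ : ℂ) σ n)⁻¹‖ ≤ B := fun n => hB ⟨n, rfl⟩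
  refine ⟨max A B, ((norm_nonneg _).trans (hA' 0)).trans (le_max_left _ _),
    fun q y hq hy n => ?_⟩
  have hle : ∀ i : ℕ, ‖q ^ i * y‖ ≤ σ ^ i * ρ := fun i => by
    rw [norm_mul, norm_pow]
    gcongr
  have hlt : ∀ i : ℕ, σ ^ i * ρ < 1 := fun i => by
    calc σ ^ i * ρ ≤ 1 * ρ := by
          gcongr
          exact pow_le_one₀ hσ0 hσ.le
      _ < 1 := by simpa using hρ
  constructor
  · refine le_trans ?_ ((hA' n).trans (le_max_left _ _))
    rw [qPoch, qPoch, norm_prod, norm_prod]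
    refine Finset.prod_le_prod (fun _ _ => norm_nonneg _) fun i _ => ?_
    have e : ‖(1 - (σ : ℂ) ^ i * -ρ)‖ = 1 + σ ^ i * ρ := by
      rw [show (1 - (σ : ℂ) ^ i * -ρ) = ((1 + σ ^ i * ρ : ℝ) : ℂ) by push_cast; ring,
        Complex.norm_real, Real.norm_of_nonneg (by positivity)]
    rw [e]
    calc ‖1 - q ^ i * y‖ ≤ ‖(1 : ℂ)‖ + ‖q ^ i * y‖ := norm_sub_le _ _
      _ ≤ 1 + σ ^ i * ρ := by
          rw [norm_one]
          linarith [hle i]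
  · refine le_trans ?_ ((hB' n).trans (le_max_right _ _))
    rw [norm_inv, norm_inv]
    have e : ∀ i : ℕ, ‖(1 - (σ : ℂ) ^ i * ρ)‖ = 1 - σ ^ i * ρ := fun i => by
      rw [show (1 - (σ : ℂ) ^ i * ρ) = ((1 - σ ^ i * ρ : ℝ) : ℂ) by push_cast; ring,
        Complex.norm_real, Real.norm_of_nonneg (by linarith [hlt i])]
    refine inv_anti₀ (norm_pos_iff.2 (qPoch_ne_zero_of_norm_lt hσ' hρ' n)) ?_
    rw [qPoch, qPoch, norm_prod, norm_prod]
    refine Finset.prod_le_prod (fun _ _ => norm_nonneg _) fun i _ => ?_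
    rw [e]
    have := norm_sub_norm_le (1 : ℂ) (q ^ i * y)
    rw [norm_one] at this
    linarith [hle i]

theorem summable_pow_sq {a : ℝ} (ha0 : 0 ≤ a) (ha : a < 1) : Summable fun n : ℕ => a ^ n ^ 2 :=
  (summable_geometric_of_lt_one ha0 ha).of_nonneg_of_le (fun _ => by positivity) fun n =>
    pow_le_pow_of_le_one ha0 ha.le (by nlinarith [Nat.zero_le n, sq_nonneg ((n : ℤ))])

theorem exists_norm_inv_one_sub_le {p : ℂ} (hp0 : p ≠ 0) (hp : ‖p‖ < 1) {x : ℂ} (hx : x ≠ 0) :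
    ∃ W : ℝ, ∀ r : ℤ, ‖(1 - x * p ^ r)⁻¹‖ ≤ W := by
  have hpt : Tendsto (fun n : ℕ => p ^ n) atTop (𝓝 0) :=
    tendsto_pow_atTop_nhds_zero_of_norm_lt_one hp
  have h1 : Tendsto (fun n : ℕ => ‖(1 - x * p ^ n)⁻¹‖) atTop (𝓝 ‖(1 - x * 0 : ℂ)⁻¹‖) :=
    (((hpt.const_mul x).const_sub 1).inv₀ (by simp)).norm
  have h2 : Tendsto (fun n : ℕ => ‖p ^ n * (p ^ n - x)⁻¹‖) atTop (𝓝 ‖0 * (0 - x : ℂ)⁻¹‖) :=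
    (hpt.mul ((hpt.sub_const x).inv₀ (by simpa using hx))).norm
  obtain ⟨A, hA⟩ := h1.bddAbove_range
  obtain ⟨B, hB⟩ := h2.bddAbove_range
  refine ⟨max A B, fun r => ?_⟩
  obtain ⟨n, rfl | rfl⟩ := r.eq_nat_or_neg
  · exact le_trans (hA ⟨n, by simp⟩) (le_max_left _ _)
  · refine le_trans (hB ⟨n, ?_⟩) (le_max_right _ _)
    have := pow_ne_zero n hp0
    simp only [zpow_neg, zpow_natCast]
    rw [show 1 - x * (p ^ n)⁻¹ = (p ^ n)⁻¹ * (p ^ n - x) by field_simp, mul_inv, inv_inv]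

/-! ### Partial fractions and a conjugate Bailey pair -/

/-- The partial fraction decomposition of `1 / ((x; p)_{n+1} (p/x; p)_n)`. -/
theorem tsum_partial_fraction {p x : ℂ} (hp0 : p ≠ 0) (hp : ‖p‖ < 1) (hx : x ≠ 0)
    (h : ∀ r : ℤ, 1 - x * p ^ r ≠ 0) (n : ℕ) :
    ∑' r : ℤ, thetaTerm p p r / (1 - x * p ^ r) * (invPoch p (n - r) * invPoch p (n + r))
      = (qPoch x p (n + 1) * qPoch (p / x) p n)⁻¹ := by
  induction n with
  | zero =>
    rw [tsum_eq_single 0]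
    · simp [thetaTerm, invPoch_zero, qPoch_succ, qPoch_zero]
    · intro r hr
      rcases lt_or_gt_of_ne hr with h | h
      · rw [invPoch_of_neg p (show ((0 : ℕ) : ℤ) + r < 0 by push_cast; omega)]
        simp
      · rw [invPoch_of_neg p (show ((0 : ℕ) : ℤ) - r < 0 by push_cast; omega)]
        simp
  | succ n ih =>
    have hn1 : 1 - p ^ (n + 1) * x ≠ 0 := by
      have := h (n + 1 : ℕ)
      rwa [zpow_natCast, mul_comm] at this
    have hn2 : 1 - p ^ n * (p / x) ≠ 0 := by
      have h3 := h (-(n + 1 : ℕ))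
      contrapose! h3
      rw [zpow_neg, zpow_natCast]
      field_simp at h3 ⊢
      rw [pow_succ]
      linear_combination -h3
    have key : ∀ r : ℤ, ((1 - p ^ (n + 1) * x) * (1 - p ^ n * (p / x))) *
        (thetaTerm p p r / (1 - x * p ^ r) *
          (invPoch p ((n + 1 : ℕ) - r) * invPoch p ((n + 1 : ℕ) + r)))
        = thetaTerm p p r / (1 - x * p ^ r) * (invPoch p (n - r) * invPoch p (n + r))
        + (p ^ (n + 1) * (thetaTerm p 1 r *
            (invPoch p ((n + 1 : ℕ) - r) * invPoch p ((n + 1 : ℕ) + r)))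
        - p ^ (n + 1) * x⁻¹ * (thetaTerm p p r *
            (invPoch p ((n + 1 : ℕ) - r) * invPoch p ((n + 1 : ℕ) + r)))) := by
      intro r
      have e1 := invPoch_eq hp (n - r)
      have e2 := invPoch_eq hp (n + r)
      rw [show (n : ℤ) - r + 1 = (n + 1 : ℕ) - r by push_cast; ring] at e1
      rw [show (n : ℤ) + r + 1 = (n + 1 : ℕ) + r by push_cast; ring] at e2
      rw [zpow_sub₀ hp0, zpow_natCast] at e1
      rw [zpow_add₀ hp0, zpow_natCast] at e2
      have e3 : thetaTerm p p r = p ^ r * thetaTerm p 1 r := by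
        simpa using thetaTerm_mul p 1 p r
      have hr := h r
      have hpr := zpow_ne_zero r hp0
      rw [e1, e2, e3]
      field_simp
      ring
    -- The last two parts of `key` sum to zero, by the triple product at the zeros `1` and `p`.
    have hz : ∀ z : ℂ, z = 1 ∨ z = p →
        qBinomialSum p z ((n + 1 : ℕ) : ℤ) ((n + 1 : ℕ) : ℤ) = 0 := by
      intro z h1
      have hz0 : z ≠ 0 := by rcases h1 with rfl | rfl <;> simp [hp0]
      have h2 := qBinomialSum_mul hp0 hp hz0 (n + 1) (n + 1)
      have h3 : qPoch z p (n + 1) * qPoch (p / z) p (n + 1) = 0 := by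
        rcases h1 with rfl | rfl
        · simp [qPoch_succ']
        · simp [qPoch_succ', div_self hp0]
      rw [h3] at h2
      exact (mul_eq_zero.1 h2).resolve_left (qPoch_ne_zero_of_norm_lt hp hp _)
    have hz1 := hz 1 (Or.inl rfl)
    have hzp := hz p (Or.inr rfl)
    have hs := fun f => summable_of_invPoch_mul p f
    rw [qBinomialSum] at hz1 hzp
    rw [qPoch_succ, qPoch_succ (p / x), show qPoch x p (n + 1) * (1 - p ^ (n + 1) * x) *
      (qPoch (p / x) p n * (1 - p ^ n * (p / x))) = ((1 - p ^ (n + 1) * x) *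
      (1 - p ^ n * (p / x))) * (qPoch x p (n + 1) * qPoch (p / x) p n) by ring, mul_inv, ← ih,
      eq_inv_mul_iff_mul_eq₀ (mul_ne_zero hn1 hn2), ← tsum_mul_left, tsum_congr key,
      Summable.tsum_add (hs _ _ _) (((hs _ _ _).mul_left _).sub ((hs _ _ _).mul_left _)),
      Summable.tsum_sub ((hs _ _ _).mul_left _) ((hs _ _ _).mul_left _), tsum_mul_left,
      tsum_mul_left, hz1, hzp]
    ring

/-- The summand `s^{n²} (-s; s²)_n / ((s²; s²)_{n-r} (s²; s²)_{n+r})` of the conjugate Bailey pair,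
zero for `n < |r|` by the convention in `invPoch`. -/
noncomputable def baileyTerm (s : ℂ) (r : ℤ) (n : ℕ) : ℂ :=
  s ^ n ^ 2 * qPoch (-s) (s ^ 2) n * (invPoch (s ^ 2) (n - r) * invPoch (s ^ 2) (n + r))

theorem exists_norm_mul_invPoch_le {s : ℂ} (hs : ‖s‖ < 1) :
    ∃ B : ℝ, 0 ≤ B ∧ ∀ (n : ℕ) (a b : ℤ), ‖qPoch (-s) (s ^ 2) n *
      (invPoch (s ^ 2) a * invPoch (s ^ 2) b)‖ ≤ B := by
  have hs2 := norm_pow_lt_one hs two_ne_zero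
  obtain ⟨K, hK0, hK⟩ := exists_norm_invPoch_le hs2
  obtain ⟨C, hC0, hC⟩ := exists_norm_qPoch_le (norm_nonneg s) hs (norm_nonneg (s ^ 2)) hs2
  refine ⟨C * (K * K), by positivity, fun n a b => ?_⟩
  rw [norm_mul, norm_mul]
  gcongr
  · exact (hC _ _ le_rfl (norm_neg s).le n).1
  · exact hK _
  · exact hK _

theorem summable_norm_baileyTerm {s : ℂ} (hs : ‖s‖ < 1) (r : ℤ) :
    Summable fun n => ‖baileyTerm s r n‖ := by
  obtain ⟨B, hB0, hB⟩ := exists_norm_mul_invPoch_le hs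
  refine ((summable_pow_sq (norm_nonneg s) hs).mul_right B).of_nonneg_of_le
    (fun _ => norm_nonneg _) fun n => ?_
  rw [baileyTerm, mul_assoc, norm_mul, norm_pow]
  gcongr
  exact hB _ _ _

theorem hasSum_telescope {v : ℕ → ℂ} {f : ℕ → ℂ} (hf : Summable f)
    (h : ∀ n, f n = v n - v (n + 1)) (hv : Tendsto v atTop (𝓝 0)) : HasSum f (v 0) := by
  have h1 : Tendsto (fun n => v 0 - v n) atTop (𝓝 (∑' n, f n)) :=
    hf.hasSum.tendsto_sum_nat.congr fun n => by simp only [h, Finset.sum_range_sub']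
  have h2 : Tendsto (fun n => v 0 - v n) atTop (𝓝 (v 0)) := by simpa using hv.const_sub (v 0)
  rw [← tendsto_nhds_unique h1 h2]
  exact hf.hasSum

/-- The sums `s^{-r²} ∑ₙ baileyTerm s r n` do not depend on `r`, by creative telescoping. -/
theorem tsum_baileyTerm_succ {s : ℂ} (hs0 : s ≠ 0) (hs : ‖s‖ < 1) (r : ℕ) :
    ∑' n, baileyTerm s (r + 1 : ℕ) n = s ^ (2 * r + 1) * ∑' n, baileyTerm s r n := by
  obtain ⟨B, hB0, hB⟩ := exists_norm_mul_invPoch_le hs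
  have hs2 := norm_pow_lt_one hs two_ne_zero
  have hsum := fun r => (summable_norm_baileyTerm hs r).of_norm
  -- The telescoping certificate.
  let v : ℕ → ℂ := fun n => (1 - s ^ (2 * r + 1)) * (s ^ n ^ 2 * (qPoch (-s) (s ^ 2) n *
    (invPoch (s ^ 2) (n - r - 1) * invPoch (s ^ 2) (n + r))))
  have hv : Tendsto v atTop (𝓝 0) := by
    have h1 : Tendsto (fun n : ℕ => ‖s‖ ^ n ^ 2 * B) atTop (𝓝 0) := by
      simpa using (summable_pow_sq (norm_nonneg s) hs).tendsto_atTop_zero.mul_const B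
    have h2 : Tendsto (fun n : ℕ => s ^ n ^ 2 * (qPoch (-s) (s ^ 2) n *
      (invPoch (s ^ 2) (n - r - 1) * invPoch (s ^ 2) (n + r)))) atTop (𝓝 0) := by
      refine squeeze_zero_norm (fun n => ?_) h1
      rw [norm_mul, norm_pow]
      gcongr
      exact hB _ _ _
    simpa [v] using h2.const_mul (1 - s ^ (2 * r + 1))
  have hv0 : v 0 = 0 := by
    simp only [v]
    rw [invPoch_of_neg _ (show ((0 : ℕ) : ℤ) - r - 1 < 0 by push_cast; omega)]
    simp
  have key : ∀ n, baileyTerm s (r + 1 : ℕ) n - s ^ (2 * r + 1) * baileyTerm s r n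
      = v n - v (n + 1) := by
    intro n
    have e1 := invPoch_eq hs2 (n - r - 1)
    have e2 := invPoch_eq hs2 (n + r)
    rw [show (n : ℤ) - r - 1 + 1 = n - r by ring] at e1
    have hsn := pow_ne_zero r hs0
    have a1 : (s ^ 2) ^ ((n : ℤ) - r) = (s ^ n) ^ 2 / (s ^ r) ^ 2 := by
      rw [zpow_sub₀ (pow_ne_zero 2 hs0), zpow_natCast, zpow_natCast]
      ring
    have a2 : (s ^ 2) ^ ((n : ℤ) + r + 1) = (s ^ n) ^ 2 * (s ^ r) ^ 2 * s ^ 2 := by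
      rw [show (n : ℤ) + r + 1 = ((n + r + 1 : ℕ) : ℤ) by push_cast; ring, zpow_natCast]
      ring
    rw [a1] at e1
    rw [a2] at e2
    simp only [v, baileyTerm]
    rw [show (n : ℤ) - (r + 1 : ℕ) = n - r - 1 by push_cast; ring,
      show (n : ℤ) + (r + 1 : ℕ) = n + r + 1 by push_cast; ring,
      show ((n + 1 : ℕ) : ℤ) - r - 1 = n - r by push_cast; ring,
      show ((n + 1 : ℕ) : ℤ) + r = n + r + 1 by push_cast; ring, qPoch_succ, e1, e2]
    field_simp
    ring
  have h1 := hasSum_telescope ((hsum (r + 1 : ℕ)).sub ((hsum r).mul_left (s ^ (2 * r + 1)))) key hv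
  rw [hv0] at h1
  have h2 := h1.tsum_eq
  rw [Summable.tsum_sub (hsum _) ((hsum _).mul_left _), tsum_mul_left] at h2
  exact sub_eq_zero.1 h2

theorem tsum_baileyTerm_natCast {s : ℂ} (hs0 : s ≠ 0) (hs : ‖s‖ < 1) (r : ℕ) :
    ∑' n, baileyTerm s r n = s ^ r ^ 2 * ∑' n, baileyTerm s 0 n := by
  induction r with
  | zero => simp
  | succ r ih =>
    rw [tsum_baileyTerm_succ hs0 hs, ih]
    ring

/-- The common value of the sums `s^{-r²} ∑ₙ baileyTerm s r n`, found by letting `r` tend to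
infinity: after the shift `n = k + r` only the term `k = 0` survives. -/
theorem tsum_baileyTerm_zero {s : ℂ} (hs0 : s ≠ 0) (hs : ‖s‖ < 1) :
    ∑' n, baileyTerm s 0 n = qPochInf (-s) (s ^ 2) / qPochInf (s ^ 2) (s ^ 2) := by
  obtain ⟨B, hB0, hB⟩ := exists_norm_mul_invPoch_le hs
  have hs2 := norm_pow_lt_one hs two_ne_zero
  have h1 : ∀ r : ℕ, ∑' k : ℕ, s ^ (k ^ 2 + 2 * r * k) * (qPoch (-s) (s ^ 2) (k + r) *
      (invPoch (s ^ 2) k * invPoch (s ^ 2) (k + 2 * r : ℕ))) = ∑' n, baileyTerm s 0 n := by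
    intro r
    have h2 := (summable_norm_baileyTerm hs r).of_norm.sum_add_tsum_nat_add r
    rw [Finset.sum_eq_zero, zero_add, tsum_baileyTerm_natCast hs0 hs] at h2
    · refine mul_left_cancel₀ (pow_ne_zero (r ^ 2) hs0) ?_
      rw [← h2, ← tsum_mul_left]
      refine tsum_congr fun k => ?_
      rw [baileyTerm, show ((k + r : ℕ) : ℤ) - r = k by push_cast; ring,
        show ((k + r : ℕ) : ℤ) + r = (k + 2 * r : ℕ) by push_cast; ring]
      ring
    · intro n hn
      rw [baileyTerm, invPoch_of_neg _ (show (n : ℤ) - r < 0 by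
        have := Finset.mem_range.1 hn
        omega)]
      simp
  have hlim : Tendsto (fun r : ℕ => ∑' k : ℕ, s ^ (k ^ 2 + 2 * r * k) *
      (qPoch (-s) (s ^ 2) (k + r) * (invPoch (s ^ 2) k * invPoch (s ^ 2) (k + 2 * r : ℕ)))) atTop
      (𝓝 (∑' k : ℕ, if k = 0 then
        qPochInf (-s) (s ^ 2) * (qPochInf (s ^ 2) (s ^ 2))⁻¹ else 0)) := by
    refine tendsto_tsum_of_dominated_convergence (bound := fun k => ‖s‖ ^ k ^ 2 * B)
      ((summable_pow_sq (norm_nonneg s) hs).mul_right B) (fun k => ?_)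
      (.of_forall fun r k => ?_)
    · split_ifs with hk
      · subst hk
        simp only [Nat.cast_zero, invPoch_zero, one_mul, zero_add, mul_zero, zero_pow two_ne_zero,
          pow_zero]
        refine (tendsto_qPoch hs2 (-s)).mul ((tendsto_invPoch hs2).comp ?_)
        exact tendsto_natCast_atTop_atTop.comp (tendsto_id.const_mul_atTop' two_pos)
      · have h3 : Tendsto (fun r : ℕ => ‖s‖ ^ r * B) atTop (𝓝 0) := by
          simpa using (tendsto_pow_atTop_nhds_zero_of_lt_one (norm_nonneg s) hs).mul_const B
        refine squeeze_zero_norm (fun r => ?_) h3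
        rw [norm_mul, norm_pow]
        refine mul_le_mul (pow_le_pow_of_le_one (norm_nonneg s) hs.le ?_) (hB _ _ _)
          (norm_nonneg _) (by positivity)
        have : 1 ≤ k := Nat.one_le_iff_ne_zero.2 hk
        nlinarith
    · rw [norm_mul, norm_pow]
      refine mul_le_mul (pow_le_pow_of_le_one (norm_nonneg s) hs.le ?_) (hB _ _ _)
        (norm_nonneg _) (by positivity)
      exact Nat.le_add_right _ _
  simp only [h1, tsum_ite_eq] at hlim
  rw [div_eq_mul_inv]
  exact tendsto_nhds_unique tendsto_const_nhds hlim

theorem tsum_baileyTerm {s : ℂ} (hs0 : s ≠ 0) (hs : ‖s‖ < 1) (r : ℤ) :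
    ∑' n, baileyTerm s r n
      = s ^ r ^ 2 * (qPochInf (-s) (s ^ 2) / qPochInf (s ^ 2) (s ^ 2)) := by
  rw [← tsum_baileyTerm_zero hs0 hs]
  obtain ⟨n, rfl | rfl⟩ := r.eq_nat_or_neg
  · rw [tsum_baileyTerm_natCast hs0 hs]
    norm_cast
  · rw [neg_sq, show ∑' k, baileyTerm s (-n) k = ∑' k, baileyTerm s n k from
      tsum_congr fun k => by
        rw [baileyTerm, baileyTerm, sub_neg_eq_add, ← sub_eq_add_neg,
          mul_comm (invPoch (s ^ 2) (k + n))], tsum_baileyTerm_natCast hs0 hs]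
    norm_cast

/-- The Bailey-type transformation that turns a basic hypergeometric series into a bilateral
Appell-Lerch series: expand each summand by partial fractions in `x` and exchange the sums. -/
theorem tsum_eq_appell_series {s x : ℂ} (hs0 : s ≠ 0) (hs : ‖s‖ < 1) (hx : x ≠ 0)
    (h : ∀ r : ℤ, 1 - x * (s ^ 2) ^ r ≠ 0) :
    ∑' n : ℕ, s ^ n ^ 2 * qPoch (-s) (s ^ 2) n *
        (qPoch x (s ^ 2) (n + 1) * qPoch (s ^ 2 / x) (s ^ 2) n)⁻¹
      = qPochInf (-s) (s ^ 2) / qPochInf (s ^ 2) (s ^ 2) *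
        ∑' r : ℤ, thetaTerm (s ^ 2) (s ^ 2) r / (1 - x * (s ^ 2) ^ r) * s ^ r ^ 2 := by
  have hs2 := norm_pow_lt_one hs two_ne_zero
  have hp0 := pow_ne_zero 2 hs0
  obtain ⟨B, hB0, hB⟩ := exists_norm_mul_invPoch_le hs
  obtain ⟨W, hW⟩ := exists_norm_inv_one_sub_le hp0 hs2 hx
  have hW0 : 0 ≤ W := (norm_nonneg _).trans (hW 0)
  let F : ℕ → ℤ → ℂ := fun n r => thetaTerm (s ^ 2) (s ^ 2) r / (1 - x * (s ^ 2) ^ r) *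
    baileyTerm s r n
  have hF : Summable (Function.uncurry F) := by
    refine Summable.of_norm_bounded (g := fun z : ℕ × ℤ => (‖s‖ ^ z.1 ^ 2 * B) *
      (‖thetaTerm (s ^ 2) (s ^ 2) z.2‖ * W)) ?_ ?_
    · exact Summable.mul_of_nonneg ((summable_pow_sq (norm_nonneg s) hs).mul_right B)
        ((summable_norm_thetaTerm hp0 hs2 hp0).mul_right W) (fun _ => by positivity)
        (fun _ => by positivity)
    · rintro ⟨n, r⟩
      simp only [Function.uncurry, F, baileyTerm]
      rw [div_eq_mul_inv, mul_assoc (s ^ n ^ 2), norm_mul, norm_mul, norm_mul, norm_pow,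
        mul_comm]
      gcongr
      · exact hB _ _ _
      · exact hW _
  calc _ = ∑' n, ∑' r, F n r := by
        refine tsum_congr fun n => ?_
        rw [← tsum_partial_fraction hp0 hs2 hx h n, ← tsum_mul_left]
        refine tsum_congr fun r => ?_
        simp only [F, baileyTerm]
        ring
    _ = ∑' r, ∑' n, F n r := hF.tsum_comm.symm
    _ = _ := by
        rw [← tsum_mul_left]
        refine tsum_congr fun r => ?_
        simp only [F]
        rw [tsum_mul_left, tsum_baileyTerm hs0 hs]
        ring

/-! ### The mock theta function as an Appell-Lerch series -/

/-- The general term of `L(x) = ∑ xⁿ q^{n²} (-q; q²)_n / (xq; q²)_n`, the deformation of the series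
defining `V0` (the case `x = 1`) which satisfies a first-order recurrence under `x ↦ q⁴x`. -/
noncomputable def deformedTerm (q x : ℂ) (n : ℕ) : ℂ :=
  x ^ n * (q ^ n ^ 2 * (qPoch (-q) (q ^ 2) n * (qPoch (x * q) (q ^ 2) n)⁻¹))

theorem norm_sq_lt {q : ℂ} (hq : ‖q‖ < 1) : ‖q ^ 2‖ < 1 := norm_pow_lt_one hq two_ne_zero

theorem exists_norm_deformedTerm_le {q : ℂ} (hq : ‖q‖ < 1) :
    ∃ B : ℝ, 0 ≤ B ∧ ∀ x : ℂ, ‖x‖ ≤ 1 → ∀ n, ‖deformedTerm q x n‖ ≤ ‖q‖ ^ n ^ 2 * B := by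
  obtain ⟨C, hC0, hC⟩ := exists_norm_qPoch_le (norm_nonneg q) hq (norm_nonneg (q ^ 2))
    (norm_sq_lt hq)
  refine ⟨C * C, by positivity, fun x hx n => ?_⟩
  have hxq : ‖x * q‖ ≤ ‖q‖ := by
    rw [norm_mul]
    exact mul_le_of_le_one_left (norm_nonneg _) hx
  rw [deformedTerm, norm_mul, norm_mul, norm_mul, norm_pow, norm_pow]
  calc ‖x‖ ^ n * (‖q‖ ^ n ^ 2 * (‖qPoch (-q) (q ^ 2) n‖ * ‖(qPoch (x * q) (q ^ 2) n)⁻¹‖))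
      ≤ 1 * (‖q‖ ^ n ^ 2 * (C * C)) := by
        gcongr
        · exact pow_le_one₀ (norm_nonneg _) hx
        · exact (hC _ _ le_rfl (norm_neg q).le n).1
        · exact (hC _ _ le_rfl hxq n).2
    _ = _ := one_mul _

theorem summable_deformedTerm {q x : ℂ} (hq : ‖q‖ < 1) (hx : ‖x‖ ≤ 1) :
    Summable (deformedTerm q x) := by
  obtain ⟨B, _, hB⟩ := exists_norm_deformedTerm_le hq
  exact ((summable_pow_sq (norm_nonneg q) hq).mul_right B).of_norm_bounded (hB x hx)

/-- The recurrence for `L(x)`, by creative telescoping with the certificate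
`1 / (1 - x q^{2n+1})`. -/
theorem tsum_deformedTerm {q x : ℂ} (hq : ‖q‖ < 1) (hx : ‖x‖ ≤ 1) :
    ∑' n, deformedTerm q x n = (1 - x * q)⁻¹ + x * q ^ 2 * (1 + x * q ^ 2) *
      ((1 - x * q) * (1 - x * q ^ 3))⁻¹ * ∑' n, deformedTerm q (x * q ^ 4) n := by
  have hq2 := norm_sq_lt hq
  have hxq : ‖x * q‖ < 1 := by
    rw [norm_mul]
    exact (mul_le_of_le_one_left (norm_nonneg _) hx).trans_lt hq
  have hx4 : ‖x * q ^ 4‖ ≤ 1 := by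
    rw [norm_mul, norm_pow]
    exact mul_le_one₀ hx (by positivity) (pow_le_one₀ (norm_nonneg _) hq.le)
  have hne : ∀ n : ℕ, 1 - (q ^ 2) ^ n * (x * q) ≠ 0 := fun n h =>
    pow_mul_ne_one hq2 hxq n (by linear_combination -h)
  have hP := qPoch_ne_zero_of_norm_lt hq2 hxq
  have hs1 := summable_deformedTerm hq hx
  have hs2 := summable_deformedTerm hq hx4
  let c := x * q ^ 2 * (1 + x * q ^ 2) * ((1 - x * q) * (1 - x * q ^ 3))⁻¹
  let v : ℕ → ℂ := fun n => deformedTerm q x n * (1 - (q ^ 2) ^ n * (x * q))⁻¹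
  have hv : Tendsto v atTop (𝓝 0) := by
    have h1 : Tendsto (fun n : ℕ => 1 - (q ^ 2) ^ n * (x * q)) atTop (𝓝 (1 - 0 * (x * q))) :=
      ((tendsto_pow_atTop_nhds_zero_of_norm_lt_one hq2).mul_const _).const_sub 1
    simpa [v] using hs1.tendsto_atTop_zero.mul (h1.inv₀ (by simp))
  have h0 := hne 0
  have h1 := hne 1
  rw [pow_zero, one_mul] at h0
  rw [show 1 - (q ^ 2) ^ 1 * (x * q) = 1 - x * q ^ 3 by ring] at h1
  have key : ∀ n, deformedTerm q x n - c * deformedTerm q (x * q ^ 4) n = v n - v (n + 1) := by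
    intro n
    have e1 : (1 - x * q) * (1 - x * q ^ 3) * qPoch (x * q ^ 4 * q) (q ^ 2) n
        = qPoch (x * q) (q ^ 2) n * (1 - (q ^ 2) ^ n * (x * q)) *
          (1 - (q ^ 2) ^ (n + 1) * (x * q)) := by
      rw [← qPoch_succ, ← qPoch_succ, qPoch_succ', qPoch_succ',
        show q ^ 2 * (q ^ 2 * (x * q)) = x * q ^ 4 * q by ring]
      ring
    have a1 := hne n
    have a2 := hne (n + 1)
    have a3 := hP n
    have e2 : qPoch (x * q ^ 4 * q) (q ^ 2) n = qPoch (x * q) (q ^ 2) n *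
        (1 - (q ^ 2) ^ n * (x * q)) * (1 - (q ^ 2) ^ (n + 1) * (x * q)) *
        ((1 - x * q) * (1 - x * q ^ 3))⁻¹ := by
      rw [← e1]
      field_simp
    simp only [c, v, deformedTerm]
    rw [e2, qPoch_succ, qPoch_succ, show q ^ (n + 1) ^ 2 = q ^ n ^ 2 * (q ^ n) ^ 2 * q by ring,
      show (x * q ^ 4) ^ n = x ^ n * (q ^ n) ^ 4 by ring, pow_succ x]
    have b : ∀ m : ℕ, (q ^ 2) ^ m = (q ^ m) ^ 2 := fun m => by ring
    simp only [b, pow_succ q n] at a1 a2 ⊢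
    generalize q ^ n = X at *
    generalize 1 - x * q = A at h0 ⊢
    generalize 1 - x * q ^ 3 = A' at h1 ⊢
    generalize hd : 1 - X ^ 2 * (x * q) = d at *
    generalize hd' : 1 - (X * q) ^ 2 * (x * q) = d' at *
    field_simp
    rw [← hd, ← hd']
    ring
  have h := (hasSum_telescope (hs1.sub (hs2.mul_left c)) key hv).tsum_eq
  rw [Summable.tsum_sub hs1 (hs2.mul_left c), tsum_mul_left] at h
  have hv0 : v 0 = (1 - x * q)⁻¹ := by simp [v, deformedTerm, qPoch_zero]
  rw [hv0] at h
  linear_combination h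

/-- Iterating the recurrence turns the series defining `V0` into one whose denominators have the
shape `(q; q⁴)_{n+1} (q³; q⁴)_n` of `tsum_eq_appell_series`. -/
theorem tsum_deformedTerm_one {q : ℂ} (hq : ‖q‖ < 1) :
    ∑' n, deformedTerm q 1 n = ∑' n : ℕ, (q ^ 2) ^ n ^ 2 * qPoch (-q ^ 2) (q ^ 4) n *
      (qPoch q (q ^ 2) (2 * n + 1))⁻¹ := by
  have hq2 := norm_sq_lt hq
  have hq4 := norm_pow_lt_one hq four_ne_zero
  obtain ⟨C, hC0, hC⟩ := exists_norm_qPoch_le (norm_nonneg (q ^ 2)) hq2 (norm_nonneg (q ^ 4)) hq4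
  obtain ⟨D, hD0, hD⟩ := exists_norm_qPoch_le (norm_nonneg q) hq (norm_nonneg (q ^ 2)) hq2
  obtain ⟨B, hB0, hB⟩ := exists_norm_deformedTerm_le hq
  have hbound : ∀ n m : ℕ, ‖(q ^ 2) ^ n ^ 2 * qPoch (-q ^ 2) (q ^ 4) n *
      (qPoch q (q ^ 2) m)⁻¹‖ ≤ ‖q ^ 2‖ ^ n ^ 2 * (C * D) := by
    intro n m
    rw [mul_assoc, norm_mul, norm_mul, norm_pow]
    gcongr
    · exact (hC _ _ le_rfl (norm_neg _).le n).1
    · exact (hD _ _ le_rfl le_rfl m).2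
  have hsq := (summable_pow_sq (norm_nonneg _) hq2).mul_right (C * D)
  have hiter : ∀ N : ℕ, ∑' n, deformedTerm q 1 n = ∑ n ∈ Finset.range N,
      (q ^ 2) ^ n ^ 2 * qPoch (-q ^ 2) (q ^ 4) n * (qPoch q (q ^ 2) (2 * n + 1))⁻¹ +
      (q ^ 2) ^ N ^ 2 * qPoch (-q ^ 2) (q ^ 4) N * (qPoch q (q ^ 2) (2 * N))⁻¹ *
        ∑' n, deformedTerm q ((q ^ 4) ^ N) n := by
    intro N
    induction N with
    | zero => simp [qPoch_zero]
    | succ N ih =>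
      have hN : ‖(q ^ 4) ^ N‖ ≤ 1 := by
        rw [norm_pow]
        exact pow_le_one₀ (norm_nonneg _) hq4.le
      rw [ih, Finset.sum_range_succ, tsum_deformedTerm hq hN,
        show 2 * (N + 1) = 2 * N + 1 + 1 by ring, qPoch_succ _ _ (2 * N + 1),
        qPoch_succ _ _ (2 * N), qPoch_succ _ _ N, pow_succ (q ^ 4) N,
        show (q ^ 2) ^ (2 * N) * q = (q ^ 4) ^ N * q by ring,
        show (q ^ 2) ^ (2 * N + 1) * q = (q ^ 4) ^ N * q ^ 3 by ring,
        show (q ^ 2) ^ (N + 1) ^ 2 = (q ^ 2) ^ N ^ 2 * ((q ^ 4) ^ N * q ^ 2) by ring]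
      simp only [mul_inv]
      ring
  have hlim : Tendsto (fun N : ℕ => (q ^ 2) ^ N ^ 2 * qPoch (-q ^ 2) (q ^ 4) N *
      (qPoch q (q ^ 2) (2 * N))⁻¹ * ∑' n, deformedTerm q ((q ^ 4) ^ N) n) atTop (𝓝 0) := by
    have h0 := hsq.tendsto_atTop_zero.mul_const (∑' n : ℕ, ‖q‖ ^ n ^ 2 * B)
    rw [zero_mul] at h0
    refine squeeze_zero_norm (fun N => ?_) h0
    rw [norm_mul]
    refine mul_le_mul (hbound N _) ?_ (norm_nonneg _) (by positivity)
    refine tsum_of_norm_bounded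
      ((summable_pow_sq (norm_nonneg q) hq).mul_right B).hasSum (hB _ ?_)
    rw [norm_pow]
    exact pow_le_one₀ (norm_nonneg _) hq4.le
  have h1 := (Summable.of_norm_bounded hsq fun n => hbound n (2 * n + 1)).hasSum.tendsto_sum_nat
  have h2 := h1.add hlim
  rw [add_zero] at h2
  exact tendsto_nhds_unique (tendsto_const_nhds.congr hiter) h2

/-- The bilateral Appell-Lerch series `∑ (-1)^r Q^{r(r-1)/2} (cy)^r / (1 - yQ^r)`. -/
noncomputable def appellSum (Q c y : ℂ) : ℂ := ∑' r : ℤ, thetaTerm Q (c * y) r / (1 - y * Q ^ r)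

theorem summable_appellSum {Q c y : ℂ} (hQ0 : Q ≠ 0) (hQ : ‖Q‖ < 1) (hc : c ≠ 0) (hy : y ≠ 0) :
    Summable fun r : ℤ => thetaTerm Q (c * y) r / (1 - y * Q ^ r) := by
  obtain ⟨W, hW⟩ := exists_norm_inv_one_sub_le hQ0 hQ hy
  refine Summable.of_norm_bounded
    ((summable_norm_thetaTerm hQ0 hQ (mul_ne_zero hc hy)).mul_right W) fun r => ?_
  rw [div_eq_mul_inv, norm_mul]
  gcongr
  exact hW r

/-- The combination `∑ (-1)^r S^{r²} y^r (1 + yS^{2r}) / (1 - yS^{2r})` of Appell-Lerch series,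
which turns out to be a quotient of theta functions. -/
noncomputable def oddAppellSum (S y : ℂ) : ℂ :=
  appellSum (S ^ 2) S y + y * appellSum (S ^ 2) (S ^ 3) y

/-- The mock theta function as an Appell-Lerch series in the base `q⁸`. -/
theorem V0_mul_j {q : ℂ} (hq0 : q ≠ 0) (hq : ‖q‖ < 1) :
    V0 q * j (q ^ 2) (q ^ 8) = oddAppellSum (q ^ 4) (q ^ 2) +
      2 * q * appellSum (q ^ 8) (q ^ 8) (q ^ 2) := by
  have hq2 := norm_sq_lt hq
  have hq20 := pow_ne_zero 2 hq0
  have hq8 := norm_pow_lt_one hq (n := 8) (by norm_num)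
  have hq80 := pow_ne_zero 8 hq0
  have hV : V0 q = -1 + 2 * ∑' n, deformedTerm q 1 n := by
    rw [V0]
    congr 3
    ext n
    rw [deformedTerm, one_pow, one_mul, one_mul, div_eq_mul_inv, mul_assoc]
  have hone : ∀ r : ℤ, r ≠ 0 → q ^ r ≠ 1 := by
    intro r hr h
    have := congrArg norm h
    rw [norm_zpow, norm_one, zpow_eq_one_iff_right₀ (norm_nonneg _) hq.ne] at this
    exact hr this
  have hpz : ∀ r : ℤ, q * ((q ^ 2) ^ 2) ^ r = q ^ (4 * r + 1) := fun r => by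
    rw [← pow_mul, ← zpow_natCast, ← zpow_mul, zpow_add_one₀ hq0]
    push_cast
    ring
  have hden : ∀ r : ℤ, 1 - q * ((q ^ 2) ^ 2) ^ r ≠ 0 := fun r h =>
    hone (4 * r + 1) (by omega) (by rw [← hpz]; linear_combination -h)
  have hser := tsum_eq_appell_series hq20 hq2 hq0 hden
  have hR : ∀ n : ℕ, (q ^ 2) ^ n ^ 2 * qPoch (-q ^ 2) (q ^ 4) n *
      (qPoch q (q ^ 2) (2 * n + 1))⁻¹ = (q ^ 2) ^ n ^ 2 * qPoch (-q ^ 2) ((q ^ 2) ^ 2) n *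
        (qPoch q ((q ^ 2) ^ 2) (n + 1) * qPoch ((q ^ 2) ^ 2 / q) ((q ^ 2) ^ 2) n)⁻¹ := by
    intro n
    rw [qPoch_succ, qPoch_two_mul, qPoch_succ, show (q ^ 2) ^ 2 / q = q ^ 2 * q by field_simp,
      show (q ^ 2) ^ 2 = q ^ 4 by ring, show (q ^ 2) ^ (2 * n) = (q ^ 4) ^ n by ring]
    ring
  rw [tsum_deformedTerm_one hq, tsum_congr hR, hser] at hV
  -- The prefactor of the Appell-Lerch series is the reciprocal of `j(q²; q⁸)`.
  have hC : j (q ^ 2) (q ^ 8) * (qPochInf (-q ^ 2) ((q ^ 2) ^ 2) /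
      qPochInf ((q ^ 2) ^ 2) ((q ^ 2) ^ 2)) = 1 := by
    have a := psi_neg_mul hq2 hq20
    have b := qPochInf_neg_self_sq hq2
    have e2 := euler_ne_zero (norm_sq_lt hq2)
    change j (q ^ 2) (q ^ 8) * (qPochInf (-q ^ 2) ((q ^ 2) ^ 2) / euler ((q ^ 2) ^ 2)) = 1
    rw [psi, neg_neg, Even.neg_pow (by decide), show (q ^ 2) ^ 4 = q ^ 8 by ring] at a
    rw [show (q ^ 2) ^ 4 = q ^ 8 by ring] at b
    rw [← mul_div_assoc, div_eq_one_iff_eq e2]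
    refine mul_right_cancel₀ e2 ?_
    linear_combination qPochInf (-q ^ 2) ((q ^ 2) ^ 2) * a + b
  have hterm : ∀ r : ℤ, thetaTerm ((q ^ 2) ^ 2) ((q ^ 2) ^ 2) r * (q ^ 2) ^ r ^ 2
      = thetaTerm (q ^ 8) (q ^ 6) r := by
    intro r
    simp only [thetaTerm, ← zpow_natCast, ← zpow_mul, mul_assoc, ← zpow_add₀ hq0]
    congr 2
    push_cast
    linear_combination (-2) * two_mul_tri r
  have hj : HasSum (thetaTerm (q ^ 8) (q ^ 6)) (j (q ^ 2) (q ^ 8)) := by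
    have := hasSum_j hq80 hq8 (div_ne_zero hq80 hq20)
    rwa [j_div_left hq80, show q ^ 8 / q ^ 2 = q ^ 6 by field_simp] at this
  have hs : ∀ k : ℕ, Summable fun r : ℤ =>
      thetaTerm (q ^ 8) (q ^ k * q ^ 2) r / (1 - q ^ 2 * (q ^ 8) ^ r) := fun k =>
    summable_appellSum hq80 hq8 (pow_ne_zero k hq0) hq20
  obtain ⟨W, hW⟩ := exists_norm_inv_one_sub_le (pow_ne_zero 2 hq20) (norm_sq_lt hq2) hq0
  have hs0 : Summable fun r : ℤ => thetaTerm (q ^ 8) (q ^ 6) r / (1 - q * ((q ^ 2) ^ 2) ^ r) := by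
    refine Summable.of_norm_bounded
      ((summable_norm_thetaTerm hq80 hq8 (pow_ne_zero 6 hq0)).mul_right W) fun r => ?_
    rw [div_eq_mul_inv, norm_mul]
    gcongr
    exact hW r
  -- With `X = q⁴ʳ` this is `(1 + qX) / (1 - qX) = ((1 + (qX)²) + 2qX) / (1 - (qX)²)`.
  have hsplit : ∀ r : ℤ, -thetaTerm (q ^ 8) (q ^ 6) r +
      2 * (thetaTerm (q ^ 8) (q ^ 6) r / (1 - q * ((q ^ 2) ^ 2) ^ r))
      = thetaTerm (q ^ 8) (q ^ 4 * q ^ 2) r / (1 - q ^ 2 * (q ^ 8) ^ r) +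
        q ^ 2 * (thetaTerm (q ^ 8) (q ^ 12 * q ^ 2) r / (1 - q ^ 2 * (q ^ 8) ^ r)) +
        2 * q * (thetaTerm (q ^ 8) (q ^ 8 * q ^ 2) r / (1 - q ^ 2 * (q ^ 8) ^ r)) := by
    intro r
    have h1 := hden r
    have h2 : 1 - q ^ 2 * (q ^ 8) ^ r ≠ 0 := by
      have e : q ^ 2 * (q ^ 8) ^ r = q ^ (8 * r + 2) := by
        rw [← zpow_natCast, ← zpow_natCast, ← zpow_mul, ← zpow_add₀ hq0]
        push_cast
        ring_nf
      rw [e]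
      exact fun h => hone (8 * r + 2) (by omega) (by linear_combination -h)
    have e8 : (q ^ 8) ^ r = (((q ^ 2) ^ 2) ^ r) ^ 2 := by
      rw [← zpow_natCast (((q ^ 2) ^ 2) ^ r), zpow_comm, zpow_natCast]
      ring_nf
    rw [show q ^ 4 * q ^ 2 = q ^ 6 by ring, show q ^ 12 * q ^ 2 = q ^ 8 * q ^ 6 by ring,
      show q ^ 8 * q ^ 2 = (q ^ 2) ^ 2 * q ^ 6 by ring, thetaTerm_mul, thetaTerm_mul, e8]
    rw [e8] at h2
    generalize ((q ^ 2) ^ 2) ^ r = X at *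
    field_simp
    ring
  have hfin : V0 q * j (q ^ 2) (q ^ 8) = ∑' r : ℤ, (-thetaTerm (q ^ 8) (q ^ 6) r +
      2 * (thetaTerm (q ^ 8) (q ^ 6) r / (1 - q * ((q ^ 2) ^ 2) ^ r))) := by
    rw [Summable.tsum_add hj.summable.neg (hs0.mul_left 2), tsum_neg, hj.tsum_eq, tsum_mul_left,
      hV, ← tsum_congr fun r => show thetaTerm ((q ^ 2) ^ 2) ((q ^ 2) ^ 2) r /
        (1 - q * ((q ^ 2) ^ 2) ^ r) * (q ^ 2) ^ r ^ 2 = thetaTerm (q ^ 8) (q ^ 6) r /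
        (1 - q * ((q ^ 2) ^ 2) ^ r) by rw [← hterm, div_mul_eq_mul_div]]
    linear_combination (2 * ∑' r : ℤ, thetaTerm ((q ^ 2) ^ 2) ((q ^ 2) ^ 2) r /
        (1 - q * ((q ^ 2) ^ 2) ^ r) * (q ^ 2) ^ r ^ 2) * hC
  rw [hfin, tsum_congr hsplit, Summable.tsum_add ((hs 4).add ((hs 12).mul_left _))
    ((hs 8).mul_left _), Summable.tsum_add (hs 4) ((hs 12).mul_left _), tsum_mul_left,
    tsum_mul_left, oddAppellSum, appellSum, appellSum, appellSum,
    show (q ^ 4) ^ 2 = q ^ 8 by ring, show (q ^ 4) ^ 3 = q ^ 12 by ring]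

/-! ### A Liouville theorem for antiperiodic functions on the punctured plane -/

/-- `f` agrees near `z`, except possibly at `z` itself, with a function analytic at `z`. -/
def RemovableAt (f : ℂ → ℂ) (z : ℂ) : Prop := ∃ g, AnalyticAt ℂ g z ∧ f =ᶠ[𝓝[≠] z] g

theorem exists_zpow_mul_mem {Q z : ℂ} (hQ0 : Q ≠ 0) (hQ : ‖Q‖ < 1) (hz : z ≠ 0) :
    ∃ n : ℤ, ‖Q‖ < ‖Q ^ n * z‖ ∧ ‖Q ^ n * z‖ ≤ 1 := by
  have hp : 0 < ‖Q‖ := norm_pos_iff.2 hQ0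
  obtain ⟨n, hn1, hn2⟩ := exists_mem_Ioc_zpow (norm_pos_iff.2 hz) ((one_lt_inv₀ hp).2 hQ)
  refine ⟨n + 1, ?_, ?_⟩ <;> rw [norm_mul, norm_zpow, zpow_add_one₀ hp.ne']
  · rw [inv_zpow', zpow_neg, inv_lt_iff_one_lt_mul₀ (by positivity)] at hn1
    nlinarith
  · rw [inv_zpow', zpow_neg, zpow_add_one₀ hp.ne', ← one_div, le_div_iff₀ (by positivity)] at hn2
    linarith

theorem zpow_antiperiodic {Q : ℂ} {f : ℂ → ℂ} (hQ0 : Q ≠ 0)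
    (hf : ∀ z, z ≠ 0 → f (Q * z) = -f z) (n : ℤ) {z : ℂ} (hz : z ≠ 0) :
    f z = (-1) ^ n * f (Q ^ n * z) := by
  have hm : ∀ n : ℤ, Q ^ n * z ≠ 0 := fun n => mul_ne_zero (zpow_ne_zero _ hQ0) hz
  induction n using Int.induction_on with
  | zero => simp
  | succ n ih =>
    rw [ih, zpow_add_one₀ hQ0, mul_comm _ Q, mul_assoc Q, hf _ (hm _), zpow_add_one₀ (by simp)]
    ring
  | pred n ih =>
    have e : Q ^ (-(n : ℤ)) * z = Q * (Q ^ (-(n : ℤ) - 1) * z) := by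
      rw [zpow_sub_one₀ hQ0]
      field_simp
    rw [ih, e, hf _ (hm _), zpow_sub_one₀ (show (-1 : ℂ) ≠ 0 by simp)]
    norm_num

theorem tendsto_mul_left_punctured {Q : ℂ} (hQ0 : Q ≠ 0) (z : ℂ) :
    Tendsto (fun w => Q * w) (𝓝[≠] z) (𝓝[≠] (Q * z)) := by
  refine tendsto_nhdsWithin_of_tendsto_nhds_of_eventually_within _
    ((continuous_const_mul Q).continuousAt.tendsto.mono_left nhdsWithin_le_nhds) ?_
  filter_upwards [self_mem_nhdsWithin] with w hw
  simpa [hQ0] using hw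

/-- A function on the punctured plane whose singularities are all removable and which changes sign
under `z ↦ Qz` vanishes: after removing the singularities, `u ↦ f (exp u)` is entire and bounded,
hence constant. -/
theorem eventually_eq_zero_of_antiperiodic {Q : ℂ} {f : ℂ → ℂ} (hQ0 : Q ≠ 0) (hQ : ‖Q‖ < 1)
    (hf : ∀ z, z ≠ 0 → f (Q * z) = -f z)
    (hr : ∀ z, ‖Q‖ < ‖z‖ → ‖z‖ ≤ 1 → RemovableAt f z) {z : ℂ} (hz : z ≠ 0) :
    f =ᶠ[𝓝[≠] z] 0 := by
  have hr' : ∀ z, z ≠ 0 → RemovableAt f z := by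
    intro z hz
    obtain ⟨n, h1, h2⟩ := exists_zpow_mul_mem hQ0 hQ hz
    obtain ⟨g, hg, hfg⟩ := hr _ h1 h2
    refine ⟨fun w => (-1) ^ n * g (Q ^ n * w), ?_, ?_⟩
    · exact analyticAt_const.mul (hg.comp_of_eq (analyticAt_const.mul analyticAt_id) rfl)
    · have h3 := (tendsto_mul_left_punctured (zpow_ne_zero n hQ0) z).eventually hfg
      filter_upwards [h3, (eventually_ne_nhds hz).filter_mono nhdsWithin_le_nhds] with w hw hw0
      rw [zpow_antiperiodic hQ0 hf n hw0, hw]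
  -- `F` is `f` with its singularities removed.
  let F : ℂ → ℂ := fun z => limUnder (𝓝[≠] z) f
  have hF : ∀ z g, AnalyticAt ℂ g z → f =ᶠ[𝓝[≠] z] g → F z = g z := fun z g hg hfg =>
    (hg.continuousAt.tendsto.mono_left nhdsWithin_le_nhds |>.congr' hfg.symm).limUnder_eq
  have hFg : ∀ z g, AnalyticAt ℂ g z → f =ᶠ[𝓝[≠] z] g → F =ᶠ[𝓝 z] g := by
    intro z g hg hfg
    have h1 : ∀ᶠ w in 𝓝[≠] z, f =ᶠ[𝓝[≠] w] g := by
      have h2 := eventually_eventually_nhdsWithin.2 hfg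
      filter_upwards [h2, self_mem_nhdsWithin] with w hw hwz
      rw [isOpen_compl_singleton.nhdsWithin_eq hwz] at hw
      exact hw.filter_mono nhdsWithin_le_nhds
    have h2 : ∀ᶠ w in 𝓝[≠] z, F w = g w := by
      filter_upwards [h1, hg.eventually_analyticAt.filter_mono nhdsWithin_le_nhds] with w hw hgw
      exact hF w g hgw hw
    rw [eventually_nhdsWithin_iff] at h2
    filter_upwards [h2] with w hw
    by_cases hwz : w = z
    · rw [hwz]
      exact hF z g hg hfg
    · exact hw hwz
  have hFa : ∀ z, z ≠ 0 → AnalyticAt ℂ F z := fun z hz => by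
    obtain ⟨g, hg, hfg⟩ := hr' z hz
    exact hg.congr (hFg z g hg hfg).symm
  have hlim : ∀ z, z ≠ 0 → Tendsto f (𝓝[≠] z) (𝓝 (F z)) := fun z hz => by
    obtain ⟨g, hg, hfg⟩ := hr' z hz
    rw [hF z g hg hfg]
    exact (hg.continuousAt.tendsto.mono_left nhdsWithin_le_nhds).congr' hfg.symm
  have hFper : ∀ z, z ≠ 0 → F (Q * z) = -F z := by
    intro z hz
    refine tendsto_nhds_unique
      ((hlim _ (mul_ne_zero hQ0 hz)).comp (tendsto_mul_left_punctured hQ0 z)) ?_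
    refine (hlim z hz).neg.congr' ?_
    filter_upwards [(eventually_ne_nhds hz).filter_mono nhdsWithin_le_nhds] with w hw
    exact (hf w hw).symm
  have hK : IsCompact {z : ℂ | ‖Q‖ ≤ ‖z‖ ∧ ‖z‖ ≤ 1} := by
    refine (isCompact_closedBall (0 : ℂ) 1).of_isClosed_subset
      ((isClosed_le continuous_const continuous_norm).inter
        (isClosed_le continuous_norm continuous_const)) fun z hz => ?_
    simpa using hz.2
  have hcont : ContinuousOn F {z : ℂ | ‖Q‖ ≤ ‖z‖ ∧ ‖z‖ ≤ 1} := fun z hz =>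
    (hFa z (norm_pos_iff.1 ((norm_pos_iff.2 hQ0).trans_le hz.1))).continuousAt.continuousWithinAt
  obtain ⟨C, hC⟩ := hK.exists_bound_of_continuousOn hcont
  have hbdd : ∀ z, z ≠ 0 → ‖F z‖ ≤ C := by
    intro z hz
    obtain ⟨n, h1, h2⟩ := exists_zpow_mul_mem hQ0 hQ hz
    rw [zpow_antiperiodic hQ0 hFper n hz, norm_mul, norm_zpow, norm_neg, norm_one, one_zpow,
      one_mul]
    exact hC _ ⟨h1.le, h2⟩
  have hdiff : Differentiable ℂ fun u => F (Complex.exp u) := fun u =>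
    (hFa _ (Complex.exp_ne_zero u)).differentiableAt.comp u Complex.differentiableAt_exp
  have hconst : ∀ z w, z ≠ 0 → w ≠ 0 → F z = F w := by
    intro z w hz hw
    rw [← Complex.exp_log hz, ← Complex.exp_log hw]
    refine hdiff.apply_eq_apply_of_bounded ?_ _ _
    refine (Metric.isBounded_closedBall (x := (0 : ℂ)) (r := C)).subset ?_
    rintro _ ⟨u, rfl⟩
    simpa using hbdd _ (Complex.exp_ne_zero u)
  have hF0 : F z = 0 := by
    have h1 := hFper z hz
    rw [hconst _ z (mul_ne_zero hQ0 hz) hz] at h1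
    linear_combination h1 / 2
  obtain ⟨g, hg, hfg⟩ := hr' z hz
  have h1 := (hFg z g hg hfg).filter_mono (nhdsWithin_le_nhds (s := {z}ᶜ))
  filter_upwards [hfg, h1, (eventually_ne_nhds hz).filter_mono nhdsWithin_le_nhds] with w hw hw1 hw0
  rw [hw, ← hw1, hconst w z hw0 hz, hF0]
  rfl

theorem removableAt_div {f F G : ℂ → ℂ} {z : ℂ} (hF : AnalyticAt ℂ F z) (hG : AnalyticAt ℂ G z)
    (hF0 : F z = 0) (hG0 : G z ≠ 0) (h : ∀ᶠ w in 𝓝[≠] z, f w = F w / ((w - z) * G w)) :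
    RemovableAt f z := by
  obtain ⟨p, hp⟩ := hF
  refine ⟨fun w => dslope F z w / G w, ?_, ?_⟩
  · exact AnalyticAt.div ⟨_, hp.has_fpower_series_dslope_fslope⟩ hG hG0
  · filter_upwards [h, self_mem_nhdsWithin] with w hw hwz
    have : w - z ≠ 0 := sub_ne_zero.2 hwz
    rw [hw, dslope_of_ne _ hwz, slope_def_field, hF0, sub_zero, div_div]

/-! ### Two evaluations of Appell-Lerch series -/

/-- The theta function `j` with its zero at `z = 1` divided out. -/
noncomputable def jReg (z q : ℂ) : ℂ := qPochInf (q * z) q * qPochInf (q / z) q * qPochInf q q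

theorem j_eq_mul_jReg {q : ℂ} (hq : ‖q‖ < 1) (z : ℂ) : j z q = (1 - z) * jReg z q := by
  rw [j, jReg, qPochInf_eq hq z]
  ring

theorem jReg_one {q : ℂ} : jReg 1 q = euler q ^ 3 := by
  rw [jReg, mul_one, div_one, euler]
  ring

theorem jReg_ne_zero {q z : ℂ} (hq : ‖q‖ < 1) (h1 : ‖q‖ < ‖z‖) (h2 : ‖z‖ ≤ 1) :
    jReg z q ≠ 0 := by
  have hz : 0 < ‖z‖ := (norm_nonneg q).trans_lt h1
  refine mul_ne_zero (mul_ne_zero (qPochInf_ne_zero_of_norm_lt hq ?_)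
    (qPochInf_ne_zero_of_norm_lt hq ?_)) (qPochInf_ne_zero_of_norm_lt hq hq)
  · rw [norm_mul]
    exact (mul_le_of_le_one_right (norm_nonneg _) h2).trans_lt hq
  · rwa [norm_div, div_lt_one hz]

theorem analyticAt_qPochInf {q : ℂ} (hq : ‖q‖ < 1) (x : ℂ) :
    AnalyticAt ℂ (fun x => qPochInf x q) x :=
  (differentiable_qPochInf hq).analyticAt x

theorem analyticAt_jReg {q z : ℂ} (hq : ‖q‖ < 1) (hz : z ≠ 0) :
    AnalyticAt ℂ (fun z => jReg z q) z := by
  refine AnalyticAt.mul (AnalyticAt.mul ?_ ?_) analyticAt_const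
  · exact (analyticAt_qPochInf hq _).comp_of_eq (analyticAt_const.mul analyticAt_id) rfl
  · exact (analyticAt_qPochInf hq _).comp_of_eq (analyticAt_const.div analyticAt_id hz) rfl

theorem analyticAt_j {q z : ℂ} (hq : ‖q‖ < 1) (hz : z ≠ 0) :
    AnalyticAt ℂ (fun z => j z q) z := by
  simp only [j_eq_mul_jReg hq]
  exact (analyticAt_const.sub analyticAt_id).mul (analyticAt_jReg hq hz)

theorem analyticAt_j_mul {q a z : ℂ} (hq : ‖q‖ < 1) (ha : a ≠ 0) (hz : z ≠ 0) :
    AnalyticAt ℂ (fun z => j (a * z) q) z :=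
  (analyticAt_j hq (mul_ne_zero ha hz)).comp_of_eq (analyticAt_const.mul analyticAt_id) rfl

/-- Liouville's theorem as it is used here: `A` has at most a simple pole at `1`, with
`(1 - z) A(z) = B(z)`, it vanishes at the only zero `ζ` of the theta function `D` in the fundamental
annulus, and `A / D` is antiperiodic. Then `A / D` is a multiple of `j(-z) / j(z)`, the factor being
determined by the residues at `z = 1`. -/
theorem eq_theta_quotient {Q ζ : ℂ} {A B D D' : ℂ → ℂ} (hQ0 : Q ≠ 0) (hQ : ‖Q‖ < 1)
    (hB : ∀ z, ‖Q‖ < ‖z‖ → ‖z‖ < ‖Q‖⁻¹ → AnalyticAt ℂ B z)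
    (hAB : ∀ z, ‖Q‖ < ‖z‖ → ‖z‖ < ‖Q‖⁻¹ → z ≠ 1 → A z = B z / (1 - z))
    (hD : ∀ z, z ≠ 0 → AnalyticAt ℂ D z)
    (hD0 : ∀ z, ‖Q‖ < ‖z‖ → ‖z‖ ≤ 1 → z ≠ ζ → D z ≠ 0)
    (hD' : AnalyticAt ℂ D' ζ) (hD'0 : D' ζ ≠ 0) (hDD' : ∀ z, z ≠ 0 → D z = (z - ζ) * D' z)
    (hζ : ‖Q‖ < ‖ζ‖) (hζ' : ‖ζ‖ ≤ 1) (hζ1 : ζ ≠ 1) (hAζ : A ζ = 0)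
    (hper : ∀ z, z ≠ 0 → A (Q * z) / D (Q * z) = -(A z / D z))
    {z : ℂ} (hz : ‖Q‖ < ‖z‖) (hz' : ‖z‖ ≤ 1) (hz1 : z ≠ 1) (hzζ : z ≠ ζ) :
    A z * j z Q * (D 1 * j (-1) Q) = B 1 * euler Q ^ 3 * (j (-z) Q * D z) := by
  have hQp : 0 < ‖Q‖ := norm_pos_iff.2 hQ0
  have hQi : 1 < ‖Q‖⁻¹ := (one_lt_inv₀ hQp).2 hQ
  have hne : ∀ {z : ℂ}, ‖Q‖ < ‖z‖ → z ≠ 0 := fun h => norm_pos_iff.1 (hQp.trans h)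
  have h11 : ‖Q‖ < ‖(1 : ℂ)‖ := by simpa using hQ
  have hD1 : D 1 ≠ 0 := hD0 1 h11 (by simp) hζ1.symm
  have hjne : ∀ {z : ℂ}, ‖Q‖ < ‖z‖ → ‖z‖ ≤ 1 → z ≠ 1 → j z Q ≠ 0 := fun h1 h2 h3 =>
    j_ne_zero hQ hQ0 (hne h1) (zpow_mul_ne_one hQ hQ0 h1 h2 h3)
  have hj1 : j (-1) Q ≠ 0 := hjne (by simpa using hQ) (by simp) (by norm_num)
  have he := euler_ne_zero hQ
  -- The value of `c` for which the poles of `f` below at `1` cancel.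
  set c := B 1 * euler Q ^ 3 / (D 1 * j (-1) Q) with hc
  let f : ℂ → ℂ := fun z => A z / D z - c * (j (-z) Q / j z Q)
  have hf : ∀ z, z ≠ 0 → f (Q * z) = -f z := by
    intro z hz
    simp only [f]
    rw [hper z hz, ← mul_neg Q, j_mul_left hQ hQ0 (neg_ne_zero.2 hz), j_mul_left hQ hQ0 hz]
    have : -(-z)⁻¹ * j (-z) Q / (-z⁻¹ * j z Q) = -(j (-z) Q / j z Q) := by
      rw [mul_div_mul_comm, inv_neg, neg_neg, div_neg, div_self (inv_ne_zero hz)]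
      ring
    rw [this]
    ring
  have hann : ∀ {z : ℂ}, ‖Q‖ < ‖z‖ → ‖z‖ ≤ 1 → ∀ᶠ w in 𝓝[≠] z, ‖Q‖ < ‖w‖ ∧ ‖w‖ < ‖Q‖⁻¹ :=
    fun {z} h1 h2 => by
      refine Filter.Eventually.filter_mono nhdsWithin_le_nhds ?_
      exact (continuous_norm.continuousAt.eventually_const_lt h1).and
        (continuous_norm.continuousAt.eventually_lt_const (h2.trans_lt hQi))
  have hjneg : ∀ {z : ℂ}, z ≠ 0 → AnalyticAt ℂ (fun z => j (-z) Q) z := fun {z} hz => by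
    simpa only [neg_one_mul] using analyticAt_j_mul (z := z) hQ (neg_ne_zero.2 one_ne_zero) hz
  have hsub : ∀ z, AnalyticAt ℂ (fun z : ℂ => 1 - z) z := fun z =>
    analyticAt_const.sub analyticAt_id
  have hsub0 : ∀ {z : ℂ}, z ≠ 1 → 1 - z ≠ 0 := fun h => sub_ne_zero.2 h.symm
  have hr : ∀ z, ‖Q‖ < ‖z‖ → ‖z‖ ≤ 1 → RemovableAt f z := by
    intro z h1 h2
    have h3 := h2.trans_lt hQi
    have hz0 := hne h1
    by_cases hz1 : z = 1
    · subst hz1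
      refine removableAt_div (F := fun w => -(B w * jReg w Q / D w) + c * j (-w) Q)
        (G := fun w => jReg w Q) ?_ (analyticAt_jReg hQ hz0) ?_ (jReg_ne_zero hQ h1 h2) ?_
      · exact (((hB 1 h1 h3).mul (analyticAt_jReg hQ hz0)).div (hD 1 hz0) hD1).neg.add
          (analyticAt_const.mul (hjneg hz0))
      · simp only [jReg_one, hc]
        field_simp
        ring
      · have hjr := (analyticAt_jReg hQ hz0).continuousAt.eventually_ne (jReg_ne_zero hQ h1 h2)
        filter_upwards [hann h1 h2, self_mem_nhdsWithin,
          hjr.filter_mono nhdsWithin_le_nhds] with w hw hw1 hjw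
        simp only [f]
        rw [hAB w hw.1 hw.2 hw1, j_eq_mul_jReg hQ w]
        have h4 := hsub0 hw1
        have h5 : w - 1 ≠ 0 := sub_ne_zero.2 hw1
        have h6 : (1 : ℂ) - w = -(w - 1) := by ring
        rw [h6]
        -- At a zero of `D` both sides reduce to their second parts, by `x / 0 = 0`.
        by_cases hDw : D w = 0
        · simp only [hDw, div_zero]
          field_simp
          ring
        · field_simp
          ring
    · by_cases hzζ : z = ζ
      · subst hzζ
        have hj := hjne h1 h2 hz1
        refine removableAt_div
          (F := fun w => B w / (1 - w) - c * (j (-w) Q * (w - z) * D' w / j w Q))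
          (G := D') ?_ hD' ?_ hD'0 ?_
        · exact ((hB z h1 h3).div (hsub z) (hsub0 hz1)).sub (analyticAt_const.mul
            ((((hjneg hz0).mul (analyticAt_id.sub analyticAt_const)).mul hD').div
            (analyticAt_j hQ hz0) hj))
        · simp only [← hAB z h1 h3 hz1, hAζ]
          ring
        · have hDr := hD'.continuousAt.eventually_ne hD'0
          filter_upwards [hann h1 h2, self_mem_nhdsWithin,
            (eventually_ne_nhds hz1).filter_mono nhdsWithin_le_nhds,
            hDr.filter_mono nhdsWithin_le_nhds] with w hw hwz hw1 hDw
          simp only [f]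
          rw [hDD' w (hne hw.1), hAB w hw.1 hw.2 hw1]
          have h5 : w - z ≠ 0 := sub_ne_zero.2 hwz
          rw [sub_div]
          congr 1
          rw [mul_div_assoc, mul_assoc (j (-w) Q), mul_div_right_comm, mul_div_assoc,
            div_self (mul_ne_zero h5 hDw), mul_one]
      · refine ⟨fun w => B w / (1 - w) / D w - c * (j (-w) Q / j w Q), ?_, ?_⟩
        · exact (((hB z h1 h3).div (hsub z) (hsub0 hz1)).div (hD z hz0) (hD0 z h1 h2 hzζ)).sub
            (analyticAt_const.mul ((hjneg hz0).div (analyticAt_j hQ hz0) (hjne h1 h2 hz1)))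
        · filter_upwards [hann h1 h2,
            (eventually_ne_nhds hz1).filter_mono nhdsWithin_le_nhds] with w hw hw1
          simp only [f]
          rw [hAB w hw.1 hw.2 hw1]
  have hfz := eventually_eq_zero_of_antiperiodic hQ0 hQ hf hr (hne hz)
  have hA : AnalyticAt ℂ (fun w => B w / (1 - w) / D w - c * (j (-w) Q / j w Q)) z :=
    (((hB z hz (hz'.trans_lt hQi)).div (hsub z) (hsub0 hz1)).div (hD z (hne hz))
      (hD0 z hz hz' hzζ)).sub
      (analyticAt_const.mul ((hjneg (hne hz)).div (analyticAt_j hQ (hne hz)) (hjne hz hz' hz1)))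
  have hzero : B z / (1 - z) / D z - c * (j (-z) Q / j z Q) = 0 := by
    refine tendsto_nhds_unique (hA.continuousAt.tendsto.mono_left nhdsWithin_le_nhds)
      ((tendsto_congr' ?_).2 (tendsto_const_nhds (x := (0 : ℂ)) (f := 𝓝[≠] z)))
    filter_upwards [hfz, hann hz hz',
      (eventually_ne_nhds hz1).filter_mono nhdsWithin_le_nhds] with w hw hwa hw1
    rw [← hAB w hwa.1 hwa.2 hw1]
    exact hw
  rw [← hAB z hz (hz'.trans_lt hQi) hz1, hc] at hzero
  have h1 := hD0 z hz hz' hzζ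
  have h2 := hjne hz hz' hz1
  field_simp at hzero
  linear_combination hzero

/-- The series `appellSum` without its term `r = 0`. -/
noncomputable def appellReg (Q c y : ℂ) : ℂ :=
  ∑' r : ℤ, if r = 0 then 0 else thetaTerm Q (c * y) r / (1 - y * Q ^ r)

theorem appellSum_eq {Q c y : ℂ} (hQ0 : Q ≠ 0) (hQ : ‖Q‖ < 1) (hc : c ≠ 0) (hy : y ≠ 0) :
    appellSum Q c y = 1 / (1 - y) + appellReg Q c y := by
  rw [appellSum, (summable_appellSum hQ0 hQ hc hy).tsum_eq_add_tsum_ite 0, appellReg]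
  simp [thetaTerm]

theorem analyticAt_appellReg {Q c y : ℂ} (hQ0 : Q ≠ 0) (hQ : ‖Q‖ < 1) (hc : c ≠ 0)
    (h1 : ‖Q‖ < ‖y‖) (h2 : ‖y‖ < ‖Q‖⁻¹) : AnalyticAt ℂ (appellReg Q c) y := by
  have hQp : 0 < ‖Q‖ := norm_pos_iff.2 hQ0
  have hyp : 0 < ‖y‖ := hQp.trans h1
  have h2' : ‖Q‖ < ‖y‖⁻¹ := (lt_inv_comm₀ hyp hQp).1 h2
  obtain ⟨ρ, hρ1, hρ2⟩ := exists_between (lt_min h1 h2')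
  have hρp : 0 < ρ := hQp.trans hρ1
  have hyρ : ‖y‖ < ρ⁻¹ := (lt_inv_comm₀ hρp hyp).1 (hρ2.trans_le (min_le_right _ _))
  let U : Set ℂ := {w | ρ < ‖w‖ ∧ ‖w‖ < ρ⁻¹}
  have hU : IsOpen U := (isOpen_lt continuous_const continuous_norm).inter
    (isOpen_lt continuous_norm continuous_const)
  have hUy : U ∈ 𝓝 y := hU.mem_nhds ⟨hρ2.trans_le (min_le_left _ _), hyρ⟩
  have ht : ‖Q‖ / ρ < 1 := (div_lt_one hρp).2 hρ1
  have hρc : (ρ : ℂ) ≠ 0 := by exact_mod_cast hρp.ne'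
  have hden : ∀ r : ℤ, r ≠ 0 → ∀ w ∈ U, 1 - ‖Q‖ / ρ ≤ ‖1 - w * Q ^ r‖ := by
    intro r hr w hw
    rcases lt_or_gt_of_ne hr with hr | hr
    · have h3 : 1 ≤ ‖Q‖ * ‖Q‖ ^ r := by
        rw [← zpow_one_add₀ hQp.ne']
        exact one_le_zpow_of_nonpos₀ hQp hQ.le (by omega)
      have h4 : ρ / ‖Q‖ ≤ ‖w * Q ^ r‖ := by
        rw [norm_mul, norm_zpow, div_le_iff₀ hQp]
        nlinarith [hw.1]
      have h5 := norm_sub_norm_le (w * Q ^ r) 1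
      rw [norm_one, norm_sub_rev] at h5
      have h6 : 2 ≤ ρ / ‖Q‖ + ‖Q‖ / ρ := by
        rw [div_add_div _ _ hQp.ne' hρp.ne', le_div_iff₀ (by positivity)]
        nlinarith [sq_nonneg (ρ - ‖Q‖)]
      linarith
    · have h3 : ‖Q‖ ^ r ≤ ‖Q‖ := by
        simpa using zpow_le_zpow_right_of_le_one₀ hQp hQ.le (show 1 ≤ r by omega)
      have h4 : ‖w * Q ^ r‖ ≤ ‖Q‖ / ρ := by
        rw [norm_mul, norm_zpow, div_eq_inv_mul]
        gcongr
        exact hw.2.le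
      have h5 := norm_sub_norm_le 1 (w * Q ^ r)
      rw [norm_one] at h5
      linarith
  have hpow : ∀ r : ℤ, ∀ w ∈ U, ‖w ^ r‖ ≤ ‖((ρ : ℂ) ^ r)‖ + ‖((ρ : ℂ)⁻¹ ^ r)‖ := by
    intro r w hw
    have hwp : 0 < ‖w‖ := hρp.trans hw.1
    have hn : ‖(ρ : ℂ)‖ = ρ := by simp [abs_of_pos hρp]
    rw [norm_zpow, norm_zpow, norm_zpow, norm_inv, hn]
    obtain ⟨n, rfl | rfl⟩ := r.eq_nat_or_neg
    · simp only [zpow_natCast]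
      have := pow_le_pow_left₀ hwp.le hw.2.le n
      have h0 : 0 ≤ ρ ^ n := by positivity
      linarith
    · simp only [zpow_neg, zpow_natCast]
      have := inv_anti₀ (by positivity) (pow_le_pow_left₀ hρp.le hw.1.le n)
      have h0 : 0 ≤ (ρ⁻¹ ^ n)⁻¹ := by positivity
      linarith
  have hsum : Summable fun r : ℤ => (‖thetaTerm Q (ρ * c) r‖ + ‖thetaTerm Q ((ρ : ℂ)⁻¹ * c) r‖) *
      (1 - ‖Q‖ / ρ)⁻¹ :=
    ((summable_norm_thetaTerm hQ0 hQ (mul_ne_zero hρc hc)).add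
      (summable_norm_thetaTerm hQ0 hQ (mul_ne_zero (inv_ne_zero hρc) hc))).mul_right _
  refine DifferentiableOn.analyticAt (s := U) ?_ hUy
  refine Complex.differentiableOn_tsum_of_summable_norm hsum (fun r w hw => ?_) hU
    fun r w hw => ?_
  · by_cases hr : r = 0
    · simp only [hr, if_true]
      exact differentiableWithinAt_const _
    · simp only [hr, if_false]
      have hw0 : w ≠ 0 := norm_pos_iff.1 (hρp.trans hw.1)
      have h3 : 1 - w * Q ^ r ≠ 0 := norm_pos_iff.1 (lt_of_lt_of_le (by linarith) (hden r hr w hw))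
      refine DifferentiableAt.differentiableWithinAt ?_
      simp only [thetaTerm]
      have h4 : DifferentiableAt ℂ (fun w : ℂ => (c * w) ^ r) w :=
        (differentiableAt_id.const_mul c).zpow (Or.inl (mul_ne_zero hc hw0))
      fun_prop (disch := assumption)
  · by_cases hr : r = 0
    · simp only [hr, if_true, norm_zero]
      have : 0 ≤ (1 - ‖Q‖ / ρ)⁻¹ := inv_nonneg.2 (by linarith)
      positivity
    · simp only [hr, if_false]
      rw [div_eq_mul_inv, norm_mul, norm_inv, mul_comm c, thetaTerm_mul, thetaTerm_mul,
        thetaTerm_mul, norm_mul, norm_mul, norm_mul, ← add_mul]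
      gcongr
      · exact hpow r w hw
      · exact hden r hr w hw

theorem appellSum_mul {Q c y : ℂ} (hQ0 : Q ≠ 0) (hc : c ≠ 0) (hy : y ≠ 0) :
    appellSum Q c (Q * y) = -(c * y)⁻¹ * appellSum Q c y := by
  have hcy := mul_ne_zero hc hy
  rw [appellSum, appellSum, ← (Equiv.addRight (1 : ℤ)).tsum_eq
    fun r => thetaTerm Q (c * y) r / (1 - y * Q ^ r), ← tsum_mul_left]
  refine tsum_congr fun r => ?_
  rw [Equiv.coe_addRight, thetaTerm_succ hQ0 hcy, show c * (Q * y) = Q * (c * y) by ring,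
    thetaTerm_mul, zpow_add_one₀ hQ0, show Q * y * Q ^ r = y * (Q ^ r * Q) by ring]
  field_simp

theorem appellSum_inv {Q c y : ℂ} (hQ0 : Q ≠ 0) (hc : c ≠ 0) (hy : y ≠ 0) :
    appellSum Q c y⁻¹ = -y * appellSum Q (Q ^ 2 / c) y := by
  rw [appellSum, appellSum, ← (Equiv.neg ℤ).tsum_eq, ← tsum_mul_left]
  refine tsum_congr fun r => ?_
  have hr := zpow_ne_zero r hQ0
  rw [Equiv.neg_apply, thetaTerm_neg hQ0, show Q / (c * y⁻¹) = Q / c * y by field_simp,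
    show Q ^ 2 / c * y = Q * (Q / c * y) by ring, thetaTerm_mul Q _ Q, zpow_neg]
  generalize thetaTerm Q (Q / c * y) r = t
  -- At a pole both sides are zero, by `x / 0 = 0`.
  by_cases h : y * Q ^ r = 1
  · rw [h, ← mul_inv, h]
    simp
  · have h1 : 1 - y * Q ^ r ≠ 0 := sub_ne_zero.2 (Ne.symm h)
    have h2 : 1 - y⁻¹ * (Q ^ r)⁻¹ = -(1 - y * Q ^ r) / (y * Q ^ r) := by
      field_simp
      ring
    rw [h2]
    field_simp

theorem oddAppellSum_mul {S y : ℂ} (hS : S ≠ 0) (hy : y ≠ 0) :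
    oddAppellSum S (S ^ 2 * y) = -(S * y)⁻¹ * oddAppellSum S y := by
  rw [oddAppellSum, oddAppellSum, appellSum_mul (pow_ne_zero 2 hS) hS hy,
    appellSum_mul (pow_ne_zero 2 hS) (pow_ne_zero 3 hS) hy]
  field_simp
  ring

theorem oddAppellSum_inv {S y : ℂ} (hS : S ≠ 0) (hy : y ≠ 0) :
    oddAppellSum S y⁻¹ = -oddAppellSum S y := by
  rw [oddAppellSum, oddAppellSum, appellSum_inv (pow_ne_zero 2 hS) hS hy,
    appellSum_inv (pow_ne_zero 2 hS) (pow_ne_zero 3 hS) hy,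
    show (S ^ 2) ^ 2 / S = S ^ 3 by field_simp, show (S ^ 2) ^ 2 / S ^ 3 = S by field_simp]
  field_simp
  ring

/-- Since `S² · (-S)⁻¹ = -S` and the quasi-period factor there is `1`, the value at `-S` equals that
at `(-S)⁻¹`, which by oddness is its negative. -/
theorem oddAppellSum_neg_self {S : ℂ} (hS : S ≠ 0) : oddAppellSum S (-S) = 0 := by
  have h1 := oddAppellSum_mul hS (inv_ne_zero (neg_ne_zero.2 hS))
  rw [oddAppellSum_inv hS (neg_ne_zero.2 hS), show S ^ 2 * (-S)⁻¹ = -S by field_simp,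
    show -(S * (-S)⁻¹)⁻¹ = 1 by field_simp] at h1
  linear_combination h1 / 2

/-- The Appell function `m(1, z; Q)`, its summation index shifted by one. -/
theorem appell_one {Q z : ℂ} (hQ0 : Q ≠ 0) (hz : z ≠ 0) :
    appell 1 z Q = -z * appellSum Q Q z / j z Q := by
  rw [appell, one_div, inv_mul_eq_div]
  congr 1
  rw [appellSum, ← (Equiv.addRight (1 : ℤ)).tsum_eq, ← tsum_mul_left]
  refine tsum_congr fun r => ?_
  have h := thetaTerm_succ hQ0 hz r
  rw [Equiv.coe_addRight]
  change thetaTerm Q z (r + 1) / _ = _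
  rw [h, thetaTerm_mul, add_sub_cancel_right]
  ring

theorem analyticAt_one_add_mul_appellReg {Q c y : ℂ} (hQ0 : Q ≠ 0) (hQ : ‖Q‖ < 1) (hc : c ≠ 0)
    (h1 : ‖Q‖ < ‖y‖) (h2 : ‖y‖ < ‖Q‖⁻¹) :
    AnalyticAt ℂ (fun y => 1 + (1 - y) * appellReg Q c y) y :=
  analyticAt_const.add ((analyticAt_const.sub analyticAt_id).mul
    (analyticAt_appellReg hQ0 hQ hc h1 h2))

theorem appellSum_eq_div {Q c y : ℂ} (hQ0 : Q ≠ 0) (hQ : ‖Q‖ < 1) (hc : c ≠ 0) (hy : y ≠ 0)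
    (hy1 : y ≠ 1) : appellSum Q c y = (1 + (1 - y) * appellReg Q c y) / (1 - y) := by
  have : 1 - y ≠ 0 := sub_ne_zero.2 hy1.symm
  rw [appellSum_eq hQ0 hQ hc hy]
  field_simp

/-- The change of the second argument in the Appell function `m(1, z; Q)` from `z` to `-1` costs a
theta quotient. -/
theorem appellSum_change {Q : ℂ} (hQ0 : Q ≠ 0) (hQ : ‖Q‖ < 1) {z : ℂ} (hz : ‖Q‖ < ‖z‖)
    (hz' : ‖z‖ ≤ 1) (hz1 : z ≠ 1) (hzn : z ≠ -1) :
    (z * appellSum Q Q z * j (-1) Q + appellSum Q Q (-1) * j z Q) * j z Q * j (-1) Q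
      = euler Q ^ 3 * j (-z) Q ^ 2 := by
  have hQp : 0 < ‖Q‖ := norm_pos_iff.2 hQ0
  have hne : ∀ {z : ℂ}, ‖Q‖ < ‖z‖ → z ≠ 0 := fun h => norm_pos_iff.1 (hQp.trans h)
  have hneg : ∀ {z : ℂ}, z ≠ 0 → AnalyticAt ℂ (fun z => j (-z) Q) z := fun {z} hz => by
    simpa only [neg_one_mul] using analyticAt_j_mul (z := z) hQ (neg_ne_zero.2 one_ne_zero) hz
  have hjne : ∀ {z : ℂ}, ‖Q‖ < ‖z‖ → ‖z‖ ≤ 1 → z ≠ 1 → j z Q ≠ 0 := fun h1 h2 h3 =>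
    j_ne_zero hQ hQ0 (hne h1) (zpow_mul_ne_one hQ hQ0 h1 h2 h3)
  have hj1 : j (-1) Q ≠ 0 := hjne (by simpa using hQ) (by simp) (by norm_num)
  have h := eq_theta_quotient (Q := Q) (ζ := -1) (z := z)
    (A := fun z => -z * appellSum Q Q z * j (-1) Q - appellSum Q Q (-1) * j z Q)
    (B := fun z => -z * (1 + (1 - z) * appellReg Q Q z) * j (-1) Q -
      (1 - z) * (appellSum Q Q (-1) * j z Q))
    (D := fun z => j (-z) Q) (D' := fun z => jReg (-z) Q) hQ0 hQ
    (fun z h1 h2 => ((analyticAt_id.neg.mul (analyticAt_one_add_mul_appellReg hQ0 hQ hQ0 h1 h2)).mul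
      analyticAt_const).sub ((analyticAt_const.sub analyticAt_id).mul
        (analyticAt_const.mul (analyticAt_j hQ (hne h1)))))
    (fun z h1 _ h3 => by
      have : 1 - z ≠ 0 := sub_ne_zero.2 h3.symm
      simp only [appellSum_eq_div hQ0 hQ hQ0 (hne h1) h3]
      field_simp)
    (fun z hz => hneg hz)
    (fun z h1 h2 h3 => hjne (by rwa [norm_neg]) (by rwa [norm_neg])
      (fun h => h3 (by rw [← h, neg_neg])))
    ((analyticAt_jReg hQ (z := - -1) (by simp)).comp_of_eq analyticAt_id.neg rfl)
    (jReg_ne_zero hQ (by simpa using hQ) (by simp))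
    (fun z _ => by
      rw [j_eq_mul_jReg hQ]
      ring)
    (by simpa using hQ) (by simp) (by norm_num) (by ring)
    (fun z hz => by
      have hd : j (-(Q * z)) Q = z⁻¹ * j (-z) Q := by
        rw [← mul_neg, j_mul_left hQ hQ0 (neg_ne_zero.2 hz), inv_neg, neg_neg]
      simp only [hd, j_mul_left hQ hQ0 hz, appellSum_mul hQ0 hQ0 hz]
      rw [mul_comm z⁻¹ (j (-z) Q), ← div_div, ← neg_div, div_right_comm]
      congr 1
      field_simp
      ring)
    hz hz' hz1 hzn
  simp only [sub_self, zero_mul, add_zero, mul_one, sub_zero] at h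
  refine mul_right_cancel₀ hj1 ?_
  linear_combination -h

/-- The odd combination of Appell-Lerch series is a theta quotient. -/
theorem oddAppellSum_eq {S : ℂ} (hS0 : S ≠ 0) (hS : ‖S‖ < 1) {y : ℂ} (hy : ‖S ^ 2‖ < ‖y‖)
    (hy' : ‖y‖ ≤ 1) (hy1 : y ≠ 1) (hyS : y ≠ -S) :
    oddAppellSum S y * j y (S ^ 2) * (j (-S) (S ^ 2) * j (-1) (S ^ 2))
      = 2 * euler (S ^ 2) ^ 3 * (j (-y) (S ^ 2) * j (-S * y) (S ^ 2)) := by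
  have hSp : 0 < ‖S‖ := norm_pos_iff.2 hS0
  have hQ0 := pow_ne_zero 2 hS0
  have hQ := norm_sq_lt hS
  have hQp : 0 < ‖S ^ 2‖ := norm_pos_iff.2 hQ0
  have hne : ∀ {z : ℂ}, ‖S ^ 2‖ < ‖z‖ → z ≠ 0 := fun h => norm_pos_iff.1 (hQp.trans h)
  have hS1 : ‖S ^ 2‖ < ‖S‖ := by
    rw [norm_pow]
    nlinarith
  have h := eq_theta_quotient (Q := S ^ 2) (ζ := -S) (z := y) (A := oddAppellSum S)
    (B := fun y => (1 + (1 - y) * appellReg (S ^ 2) S y) +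
      y * (1 + (1 - y) * appellReg (S ^ 2) (S ^ 3) y))
    (D := fun y => j (-S * y) (S ^ 2)) (D' := fun y => y⁻¹ * jReg (-S⁻¹ * y) (S ^ 2)) hQ0 hQ
    (fun z h1 h2 => (analyticAt_one_add_mul_appellReg hQ0 hQ hS0 h1 h2).add (analyticAt_id.mul
      (analyticAt_one_add_mul_appellReg hQ0 hQ (pow_ne_zero 3 hS0) h1 h2)))
    (fun z h1 _ h3 => by
      rw [oddAppellSum, appellSum_eq_div hQ0 hQ hS0 (hne h1) h3,
        appellSum_eq_div hQ0 hQ (pow_ne_zero 3 hS0) (hne h1) h3]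
      ring)
    (fun z hz => analyticAt_j_mul hQ (neg_ne_zero.2 hS0) hz)
    (fun z h1 h2 h3 => by
      refine j_ne_zero hQ hQ0 (mul_ne_zero (neg_ne_zero.2 hS0) (hne h1)) fun r hr => ?_
      have e : z = -S ^ (-(2 * r + 1)) := by
        rw [zpow_neg, zpow_add_one₀ hS0, zpow_mul, zpow_ofNat]
        have := zpow_ne_zero r hQ0
        field_simp
        linear_combination -hr
      have en : ‖z‖ = ‖S‖ ^ (-(2 * r + 1)) := by rw [e, norm_neg, norm_zpow]
      rw [en, norm_pow, ← zpow_natCast, zpow_lt_zpow_iff_right_of_lt_one₀ hSp hS] at h1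
      rw [en, ← zpow_zero ‖S‖, zpow_le_zpow_iff_right_of_lt_one₀ hSp hS] at h2
      refine h3 ?_
      rw [e, show -(2 * r + 1) = 1 by push_cast at h1; omega, zpow_one])
    (AnalyticAt.mul (analyticAt_id.inv (neg_ne_zero.2 hS0))
      ((analyticAt_jReg hQ (z := -S⁻¹ * -S) (by simp [hS0])).comp_of_eq
        (analyticAt_const.mul analyticAt_id) rfl))
    (mul_ne_zero (inv_ne_zero (neg_ne_zero.2 hS0))
      (jReg_ne_zero hQ (by simpa [hS0] using hS) (by simp [hS0])))
    (fun z hz => by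
      have h1 := j_mul_left hQ hQ0 (mul_ne_zero (neg_ne_zero.2 (inv_ne_zero hS0)) hz)
      rw [show S ^ 2 * (-S⁻¹ * z) = -S * z by field_simp] at h1
      rw [h1, j_eq_mul_jReg hQ]
      field_simp
      ring)
    (by rwa [norm_neg]) (by rw [norm_neg]; exact hS.le)
    (fun h => by
      rw [neg_eq_iff_eq_neg] at h
      rw [h] at hS
      simp at hS)
    (oddAppellSum_neg_self hS0)
    (fun z hz => by
      have h1 := j_mul_left hQ hQ0 (mul_ne_zero (neg_ne_zero.2 hS0) hz)
      rw [show -S * (S ^ 2 * z) = S ^ 2 * (-S * z) by ring, h1, oddAppellSum_mul hS0 hz,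
        show -(-S * z)⁻¹ = (S * z)⁻¹ by rw [neg_mul, inv_neg, neg_neg], neg_mul, neg_div,
        mul_div_mul_left _ _ (inv_ne_zero (mul_ne_zero hS0 hz))])
    hy hy' hy1 hyS
  simp only [sub_self, zero_mul, add_zero, mul_one] at h
  rw [h]
  ring

/-- The mock theta function in terms of theta functions and `m(1, -1; q⁸)`. -/
theorem euler_mul_V0 {q : ℂ} (hq0 : q ≠ 0) (hq : ‖q‖ < 1) :
    euler (q ^ 8) ^ 3 * V0 q = psi (q ^ 2) ^ 4 + q⁻¹ * (phi (q ^ 4) ^ 2 * phi (q ^ 2) ^ 2 / 2 -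
      2 * euler (q ^ 8) ^ 3 * appell 1 (-1) (q ^ 8)) := by
  have hqp : 0 < ‖q‖ := norm_pos_iff.2 hq0
  have h2 := norm_sq_lt hq
  have h20 := pow_ne_zero 2 hq0
  have h4 := norm_pow_lt_one hq four_ne_zero
  have h40 := pow_ne_zero 4 hq0
  have h8 := norm_pow_lt_one hq (n := 8) (by norm_num)
  have h80 := pow_ne_zero 8 hq0
  have n82 : ‖q ^ 8‖ < ‖q ^ 2‖ := by
    rw [norm_pow, norm_pow]
    exact pow_lt_pow_right_of_lt_one₀ hqp hq (by norm_num)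
  have n42 : ‖q ^ 4‖ < ‖q ^ 2‖ := by
    rw [norm_pow, norm_pow]
    exact pow_lt_pow_right_of_lt_one₀ hqp hq (by norm_num)
  have ne1 : q ^ 2 ≠ 1 := fun h => by simp [h] at h2
  have ne2 : q ^ 2 ≠ -1 := fun h => by simp [h] at h2
  have ne3 : q ^ 2 ≠ -q ^ 4 := fun h => by
    rw [h, norm_neg] at n42
    exact n42.false
  have hP0 : j (q ^ 2) (q ^ 8) ≠ 0 :=
    j_ne_zero h8 h80 h20 (zpow_mul_ne_one h8 h80 n82 h2.le ne1)
  have hj1 : j (-1) (q ^ 8) ≠ 0 := j_ne_zero h8 h80 (by simp)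
    (zpow_mul_ne_one h8 h80 (by simpa using h8) (by simp) (by norm_num))
  have hF0 : j (-q ^ 4) (q ^ 8) ≠ 0 := by
    refine j_ne_zero h8 h80 (neg_ne_zero.2 h40) (zpow_mul_ne_one h8 h80 ?_ ?_ fun h => ?_)
    · rw [norm_neg, norm_pow, norm_pow]
      exact pow_lt_pow_right_of_lt_one₀ hqp hq (by norm_num)
    · rw [norm_neg]
      exact h4.le
    · rw [neg_eq_iff_eq_neg] at h
      simp [h] at h4
  have a := V0_mul_j hq0 hq
  have b := appellSum_change h80 h8 n82 h2.le ne1 ne2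
  have c := oddAppellSum_eq h40 h4 (y := q ^ 2) (by rwa [← pow_mul]) h2.le ne1 ne3
  have d := euler_pow_mul_psi h2 h20
  have e := psi_sq h2 h20
  have f := psi_sq (norm_sq_lt h2) (pow_ne_zero 2 h20)
  have g := appell_one (z := -1) h80 (by simp)
  have hP : psi (-q ^ 2) = j (q ^ 2) (q ^ 8) := by
    rw [psi, neg_neg, Even.neg_pow (by decide), ← pow_mul]
  have hp : j (-q ^ 2) (q ^ 8) = psi (q ^ 2) := by rw [psi, ← pow_mul]
  have hp' : j (-(q ^ 4 * q ^ 2)) (q ^ 8) = psi (q ^ 2) := by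
    rw [← hp, ← j_div_left h80]
    congr 1
    field_simp
  have hF : j (-q ^ 4) (q ^ 8) = phi (q ^ 4) := by rw [phi, ← pow_mul]
  rw [← pow_mul] at c
  simp only [← pow_mul] at d e f
  norm_num at c d e f g
  rw [hp, hp', hF, j_neg_one h8 h80] at c
  rw [hp, j_neg_one h8 h80] at b
  rw [hP] at d
  rw [j_neg_one h8 h80] at g hj1
  rw [hF] at hF0
  have hk : psi (q ^ 8) ≠ 0 := right_ne_zero_of_mul hj1
  rw [g]
  generalize j (q ^ 2) (q ^ 8) = P at *
  generalize psi (q ^ 8) = k at *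
  generalize psi (q ^ 2) = p at *
  generalize phi (q ^ 4) = F at *
  generalize phi (q ^ 2) = f' at *
  generalize psi (q ^ 4) = p' at *
  generalize euler (q ^ 8) ^ 3 = E at *
  generalize oddAppellSum (q ^ 4) (q ^ 2) = N at *
  generalize appellSum (q ^ 8) (q ^ 8) (q ^ 2) = X at *
  generalize appellSum (q ^ 8) (q ^ 8) (-1) = m at *
  have hp4 : p ^ 4 = f' ^ 2 * F * k := by
    linear_combination (p ^ 2 + f' * p') * e + f' ^ 2 * f
  have h1 : E * N = p ^ 4 * P := by
    refine mul_right_cancel₀ (mul_ne_zero (mul_ne_zero hP0 hF0) hk) ?_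
    rw [hp4]
    linear_combination (E / 2) * c + (E * p + k * P * f' * F) * d
  have h2 : E * (2 * q * X) = q⁻¹ * (F ^ 2 * f' ^ 2 / 2 - E * m / k) * P := by
    refine mul_right_cancel₀ (mul_ne_zero (mul_ne_zero hP0 (pow_ne_zero 2 hk)) hq0) ?_
    have hR : q⁻¹ * (F ^ 2 * f' ^ 2 / 2 - E * m / k) * P * (P * k ^ 2 * q)
        = F ^ 2 * f' ^ 2 * P ^ 2 * k ^ 2 / 2 - E * m * k * P ^ 2 := by field_simp
    rw [hR]
    linear_combination (E / 2) * b + ((E * p + k * P * f' * F) / 2) * d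
  refine mul_right_cancel₀ hP0 ?_
  rw [mul_assoc, a, mul_add, h1, h2]
  field_simp

/-! ### The Taylor series and its sections -/

theorem differentiableOn_V0 : DifferentiableOn ℂ V0 (Metric.ball 0 1) := by
  intro z hz
  rw [mem_ball_zero_iff] at hz
  obtain ⟨ρ, hρ1, hρ2⟩ := exists_between hz
  have hρ0 : 0 ≤ ρ := (norm_nonneg z).trans hρ1.le
  have hρsq : ρ ^ 2 < 1 := pow_lt_one₀ hρ0 hρ2 two_ne_zero
  obtain ⟨C, hC0, hC⟩ := exists_norm_qPoch_le hρ0 hρ2 (sq_nonneg ρ) hρsq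
  have hsum : Summable fun n : ℕ => ρ ^ n ^ 2 * C * C :=
    ((summable_pow_sq hρ0 hρ2).mul_right C).mul_right C
  have hd : DifferentiableOn ℂ (fun q : ℂ => ∑' n : ℕ, q ^ (n ^ 2) * qPoch (-q) (q ^ 2) n /
      qPoch q (q ^ 2) n) (Metric.ball 0 ρ) := by
    refine Complex.differentiableOn_tsum_of_summable_norm hsum (fun n q hq => ?_)
      Metric.isOpen_ball fun n q hq => ?_
    · rw [mem_ball_zero_iff] at hq
      have hne := qPoch_ne_zero_of_norm_lt (norm_sq_lt (hq.trans hρ2)) (hq.trans hρ2) n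
      refine DifferentiableAt.differentiableWithinAt (DifferentiableAt.div ?_ ?_ hne)
      · simp only [qPoch]
        fun_prop
      · simp only [qPoch]
        fun_prop
    · rw [mem_ball_zero_iff] at hq
      have hq2 : ‖q ^ 2‖ ≤ ρ ^ 2 := by
        rw [norm_pow]
        gcongr
      rw [div_eq_mul_inv, norm_mul, norm_mul, norm_pow]
      gcongr
      · exact (hC _ _ hq2 (by rw [norm_neg]; exact hq.le) n).1
      · exact (hC _ _ hq2 hq.le n).2
  have h1 := hd.differentiableAt (Metric.isOpen_ball.mem_nhds (mem_ball_zero_iff.2 hρ1))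
  exact ((h1.const_mul 2).const_add (-1)).differentiableWithinAt

theorem hasSum_g {q : ℂ} (hq : ‖q‖ < 1) : HasSum (fun n => g n * q ^ n) (V0 q) := by
  have h := Complex.hasSum_taylorSeries_on_ball (f := V0) (c := 0) (r := 1)
    (by simpa using differentiableOn_V0) (z := q) (by simpa using hq)
  refine h.congr_fun fun n => ?_
  simp only [g, sub_zero, smul_eq_mul]
  ring

theorem sum_pow_root_of_unity {x : ℂ} (hx : x ^ 8 = 1) :
    ∑ m ∈ Finset.range 8, x ^ m = if x = 1 then 8 else 0 := by
  split_ifs with h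
  · simp [h]
  · have := mul_geom_sum x 8
    rw [hx, sub_self] at this
    exact (mul_eq_zero.1 this).resolve_left (sub_ne_zero.2 h)

/-- Extraction of an arithmetic progression of power series coefficients by averaging over the
eighth roots of unity. -/
theorem hasSum_section {a : ℕ → ℂ} {V : ℂ → ℂ} {q : ℂ} (hq0 : q ≠ 0) (C : Fin 8 → ℂ)
    (hV : ∀ w, w ^ 8 = q ^ 8 → HasSum (fun n => a n * w ^ n) (V w))
    (hC : ∀ w, w ^ 8 = q ^ 8 → V w = ∑ i : Fin 8, w ^ (i : ℕ) * C i) (k : Fin 8) :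
    HasSum (fun n => a (8 * n + k) * (q ^ 8) ^ n) (C k) := by
  have hζ := Complex.isPrimitiveRoot_exp 8 (by norm_num)
  set ζ := Complex.exp (2 * Real.pi * Complex.I / (8 : ℕ)) with hζdef
  have hw : ∀ m : ℕ, (ζ ^ m * q) ^ 8 = q ^ 8 := fun m => by
    rw [mul_pow, ← pow_mul, mul_comm, mul_comm m, pow_mul, hζ.pow_eq_one, one_pow, mul_one]
  -- `ζ⁷ = ζ⁻¹`, so this is the orthogonality of the characters modulo `8`.
  have horth : ∀ n : ℕ, ∑ m ∈ Finset.range 8, ζ ^ (7 * k * m) * (ζ ^ m) ^ n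
      = if n % 8 = k then 8 else 0 := by
    intro n
    have h1 : ∀ m, ζ ^ (7 * (k : ℕ) * m) * (ζ ^ m) ^ n = (ζ ^ (n + 7 * k)) ^ m := fun m => by
      rw [← pow_mul, ← pow_mul, ← pow_add]
      congr 1
      ring
    simp only [h1]
    rw [sum_pow_root_of_unity (by rw [← pow_mul, mul_comm, pow_mul, hζ.pow_eq_one, one_pow])]
    congr 1
    rw [hζ.pow_eq_one_iff_dvd]
    have := k.2
    apply propext
    omega
  have h1 : HasSum (fun n => ∑ m ∈ Finset.range 8, ζ ^ (7 * (k : ℕ) * m) *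
      (a n * (ζ ^ m * q) ^ n)) (∑ m ∈ Finset.range 8, ζ ^ (7 * (k : ℕ) * m) * V (ζ ^ m * q)) :=
    hasSum_sum fun m _ => (hV _ (hw m)).mul_left _
  have h2 : ∑ m ∈ Finset.range 8, ζ ^ (7 * (k : ℕ) * m) * V (ζ ^ m * q)
      = 8 * (q ^ (k : ℕ) * C k) := by
    have h3 : ∀ m ∈ Finset.range 8, ζ ^ (7 * (k : ℕ) * m) * V (ζ ^ m * q) =
        ∑ i : Fin 8, (ζ ^ (7 * (k : ℕ) * m) * (ζ ^ m) ^ (i : ℕ)) * (q ^ (i : ℕ) * C i) := by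
      intro m _
      rw [hC _ (hw m), Finset.mul_sum]
      refine Finset.sum_congr rfl fun i _ => ?_
      ring
    rw [Finset.sum_congr rfl h3, Finset.sum_comm]
    simp only [← Finset.sum_mul, horth]
    rw [Finset.sum_eq_single k]
    · rw [if_pos (Nat.mod_eq_of_lt k.2)]
    · intro i _ hik
      rw [if_neg, zero_mul]
      rw [Nat.mod_eq_of_lt i.2]
      exact fun h => hik (Fin.ext h)
    · simp
  rw [h2] at h1
  have h4 : ∀ n, ∑ m ∈ Finset.range 8, ζ ^ (7 * (k : ℕ) * m) * (a n * (ζ ^ m * q) ^ n)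
      = (if n % 8 = k then 8 else 0) * (a n * q ^ n) := by
    intro n
    rw [← horth, Finset.sum_mul]
    refine Finset.sum_congr rfl fun m _ => ?_
    ring
  simp only [h4] at h1
  have hinj : Function.Injective fun n : ℕ => 8 * n + (k : ℕ) := fun x y h => by
    simpa using h
  rw [← hinj.hasSum_iff] at h1
  · have h5 := h1.mul_left (8 * q ^ (k : ℕ))⁻¹
    have hqk := pow_ne_zero (k : ℕ) hq0
    convert! h5 using 1
    · ext n
      have : (8 * n + (k : ℕ)) % 8 = k := by
        have := k.2
        omega
      simp only [Function.comp, this, if_true]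
      rw [pow_add, pow_mul]
      field_simp
    · field_simp
  · intro n hn
    rw [if_neg, zero_mul]
    intro h
    exact hn ⟨n / 8, by simp only; omega⟩

theorem qPoch_three_mul (x q : ℂ) (n : ℕ) :
    qPoch x q (3 * n) =
      qPoch x (q ^ 3) n * qPoch (q * x) (q ^ 3) n * qPoch (q ^ 2 * x) (q ^ 3) n := by
  induction n with
  | zero => simp [qPoch_zero]
  | succ n ih =>
    rw [show 3 * (n + 1) = 3 * n + 1 + 1 + 1 by ring, qPoch_succ, qPoch_succ, qPoch_succ, ih,
      qPoch_succ, qPoch_succ, qPoch_succ]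
    ring

/-- `J_1 = j(q; q³)` is Euler's product, the factors being sorted by their exponents modulo `3`. -/
theorem J_one {q : ℂ} (hq0 : q ≠ 0) (hq : ‖q‖ < 1) : J 1 q = euler q := by
  have h3 := norm_pow_lt_one hq three_ne_zero
  have h := (((tendsto_qPoch h3 q).mul (tendsto_qPoch h3 (q * q))).mul
    (tendsto_qPoch h3 (q ^ 2 * q)))
  simp only [← qPoch_three_mul] at h
  have h1 := tendsto_nhds_unique h
    ((tendsto_qPoch hq q).comp (tendsto_id.const_mul_atTop' (r := 3) three_pos))
  rw [J, J2, j, euler, Nat.cast_one, zpow_one, mul_one, ← h1, show q ^ 3 / q = q * q by field_simp,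
    show q ^ 2 * q = q ^ 3 by ring]

/-- The eight-dissection of the mock theta function: the coefficient of each `w ^ i` depends on
`Q = w ^ 8` alone. -/
theorem V0_dissection {w : ℂ} (hw0 : w ≠ 0) (hw : ‖w‖ < 1) {Q : ℂ} (hQ : w ^ 8 = Q) :
    euler Q ^ 3 * V0 w =
      psi Q * (phi Q ^ 2 * phi (Q ^ 2) + 8 * Q * psi (Q ^ 2) ^ 2 * psi (Q ^ 4)) +
      w * (2 * phi Q ^ 3 * psi (Q ^ 2)) +
      w ^ 2 * (4 * psi Q * phi Q * psi (Q ^ 2) * phi (Q ^ 2)) +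
      w ^ 3 * (4 * phi Q ^ 2 * psi (Q ^ 2) ^ 2) +
      w ^ 4 * (psi Q * (2 * phi Q ^ 2 * psi (Q ^ 4) + 4 * psi (Q ^ 2) ^ 2 * phi (Q ^ 2))) +
      w ^ 5 * (8 * phi (Q ^ 2) * phi Q * psi (Q ^ 2) * psi (Q ^ 4)) +
      w ^ 6 * (8 * psi Q * phi Q * psi (Q ^ 2) * psi (Q ^ 4)) +
      w ^ 7 * (Q⁻¹ * (phi Q ^ 4 / 2 + 8 * Q * psi (Q ^ 2) ^ 4 -
        2 * euler Q ^ 3 * appell 1 (-1) Q)) := by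
  have h2 := norm_sq_lt hw
  have h20 := pow_ne_zero 2 hw0
  have h4 := norm_pow_lt_one hw four_ne_zero
  have h40 := pow_ne_zero 4 hw0
  have h8 := norm_pow_lt_one hw (n := 8) (by norm_num)
  have h80 := pow_ne_zero 8 hw0
  have e0 := euler_mul_V0 hw0 hw
  have e1 := psi_sq h2 h20
  have e2 := psi_sq h4 h40
  have e3 := phi_sq h2 h20
  have e4 := phi_sq h4 h40
  have e5 := phi_two_dissection h4 h40
  have e6 := psi_sq h8 h80
  have e7 := psi_sq (norm_sq_lt h8) (pow_ne_zero 2 h80)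
  simp only [← pow_mul] at e1 e2 e3 e4 e5 e6 e7
  subst hQ
  simp only [← pow_mul]
  norm_num at e1 e2 e3 e4 e5 e6 e7 ⊢
  rw [e0]
  generalize appell 1 (-1) (w ^ 8) = μ at *
  generalize euler (w ^ 8) ^ 3 = E at *
  generalize psi (w ^ 32) = B at *
  generalize phi (w ^ 16) = A at *
  generalize psi (w ^ 16) = G at *
  generalize phi (w ^ 8) = F at *
  generalize psi (w ^ 8) = p at *
  generalize phi (w ^ 4) = f at *
  generalize psi (w ^ 4) = r at *
  generalize phi (w ^ 2) = t at *
  generalize psi (w ^ 2) = s at *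
  have hs : s ^ 4 = f ^ 2 * (f * p) + 4 * w ^ 2 * p ^ 2 * (f * p) := by
    rw [← e2]
    linear_combination (s ^ 2 + t * r) * e1 + r ^ 2 * e3
  have hf3 : f ^ 2 * f = (F ^ 2 + 4 * w ^ 4 * G ^ 2) * (A + 2 * w ^ 4 * B) := by rw [e4, ← e5]
  have ht : t ^ 2 * f ^ 2 = (F ^ 2 + 4 * w ^ 4 * G ^ 2) ^ 2 +
      4 * w ^ 2 * p ^ 2 * (F ^ 2 + 4 * w ^ 4 * G ^ 2) := by
    rw [e3, ← e4]
    ring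
  have hs' : s ^ 4 = p * (F ^ 2 + 4 * w ^ 4 * G ^ 2) * (A + 2 * w ^ 4 * B) +
      4 * w ^ 2 * p * (F * G) * (A + 2 * w ^ 4 * B) := by
    rw [hs, e6, e5]
    rw [e5] at hf3
    linear_combination p * hf3
  rw [hs', mul_comm (f ^ 2), ht, e6]
  field_simp
  linear_combination 16 * w ^ 6 * F * G * e7

end MockV0

open MockV0 in
theorem theorem1p1 (q : ℂ) (hq0 : q ≠ 0) (hq1 : ‖q‖ < 1) :
    HasSum (fun n : ℕ => g (8 * n) * q ^ n)
      (1 / J 1 q ^ 3 * Jbar 1 4 q *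
        (Jbar 1 2 q ^ 2 * Jbar 2 4 q + q * Jbar 0 2 q ^ 2 * Jbar 0 4 q)) ∧
    HasSum (fun n : ℕ => g (8 * n + 1) * q ^ n)
      (2 / J 1 q ^ 3 * Jbar 1 2 q ^ 3 * Jbar 2 8 q) ∧
    HasSum (fun n : ℕ => g (8 * n + 2) * q ^ n)
      (4 / J 1 q ^ 3 * Jbar 1 4 q * Jbar 1 2 q * Jbar 2 8 q * Jbar 2 4 q) ∧
    HasSum (fun n : ℕ => g (8 * n + 3) * q ^ n)
      (4 / J 1 q ^ 3 * Jbar 1 2 q ^ 2 * Jbar 2 8 q ^ 2) ∧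
    HasSum (fun n : ℕ => g (8 * n + 4) * q ^ n)
      (1 / J 1 q ^ 3 * Jbar 1 4 q *
        (Jbar 1 2 q ^ 2 * Jbar 0 4 q + Jbar 0 2 q ^ 2 * Jbar 2 4 q)) ∧
    HasSum (fun n : ℕ => g (8 * n + 5) * q ^ n)
      (8 / J 1 q ^ 3 * Jbar 2 4 q * Jbar 1 2 q * Jbar 2 8 q * Jbar 4 16 q) ∧
    HasSum (fun n : ℕ => g (8 * n + 6) * q ^ n)
      (8 / J 1 q ^ 3 * Jbar 1 4 q * Jbar 1 2 q * Jbar 2 8 q * Jbar 4 16 q) ∧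
    HasSum (fun n : ℕ => g (8 * n + 7) * q ^ n)
      (-2 * q⁻¹ * appell 1 (-1) q +
        1 / 2 * (q⁻¹ / J 1 q ^ 3) *
          (Jbar 1 2 q ^ 2 * Jbar 2 4 q ^ 2 +
            q * Jbar 0 4 q *
              (2 * Jbar 2 4 q * Jbar 0 2 q ^ 2 + Jbar 1 2 q ^ 2 * Jbar 0 4 q))) := by
  have h2 := norm_sq_lt hq1
  have h20 := pow_ne_zero 2 hq0
  have j14 : Jbar 1 4 q = psi q := by rw [Jbar, zpow_one, psi]
  have j12 : Jbar 1 2 q = phi q := by rw [Jbar, zpow_one, phi]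
  have j24 : Jbar 2 4 q = phi (q ^ 2) := by rw [Jbar, zpow_ofNat, phi, ← pow_mul]
  have j28 : Jbar 2 8 q = psi (q ^ 2) := by rw [Jbar, zpow_ofNat, psi, ← pow_mul]
  have j416 : Jbar 4 16 q = psi (q ^ 4) := by rw [Jbar, zpow_ofNat, psi, ← pow_mul]
  have j02 : Jbar 0 2 q = 2 * psi (q ^ 2) := by rw [Jbar, zpow_zero, j_neg_one h2 h20]
  have j04 : Jbar 0 4 q = 2 * psi (q ^ 4) := by
    rw [Jbar, zpow_zero, j_neg_one (norm_pow_lt_one hq1 four_ne_zero) (pow_ne_zero 4 hq0)]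
  rw [J_one hq0 hq1, j14, j12, j24, j28, j416, j02, j04]
  have e1 := phi_sq hq1 hq0
  have e2 := psi_sq h2 h20
  rw [← pow_mul] at e2
  norm_num at e2
  have hE := euler_ne_zero hq1
  obtain ⟨w, hw⟩ : ∃ w : ℂ, w ^ 8 = q := IsAlgClosed.exists_pow_nat_eq _ (by norm_num)
  have hnorm : ∀ v : ℂ, v ^ 8 = w ^ 8 → v ≠ 0 ∧ ‖v‖ < 1 := by
    intro v hv
    rw [hw] at hv
    constructor
    · rintro rfl
      exact hq0 (by rw [← hv]; simp)
    · refine lt_of_pow_lt_pow_left₀ 8 zero_le_one ?_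
      rwa [← norm_pow, hv, one_pow]
  have key := hasSum_section (a := g) (V := V0) (hnorm w rfl).1
    ![psi q * (phi q ^ 2 * phi (q ^ 2) + 8 * q * psi (q ^ 2) ^ 2 * psi (q ^ 4)) / euler q ^ 3,
      2 * phi q ^ 3 * psi (q ^ 2) / euler q ^ 3,
      4 * psi q * phi q * psi (q ^ 2) * phi (q ^ 2) / euler q ^ 3,
      4 * phi q ^ 2 * psi (q ^ 2) ^ 2 / euler q ^ 3,
      psi q * (2 * phi q ^ 2 * psi (q ^ 4) + 4 * psi (q ^ 2) ^ 2 * phi (q ^ 2)) / euler q ^ 3,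
      8 * phi (q ^ 2) * phi q * psi (q ^ 2) * psi (q ^ 4) / euler q ^ 3,
      8 * psi q * phi q * psi (q ^ 2) * psi (q ^ 4) / euler q ^ 3,
      q⁻¹ * (phi q ^ 4 / 2 + 8 * q * psi (q ^ 2) ^ 4 - 2 * euler q ^ 3 * appell 1 (-1) q) /
        euler q ^ 3]
    (fun v hv => hasSum_g (hnorm v hv).2)
    (fun v hv => by
      have h := V0_dissection (hnorm v hv).1 (hnorm v hv).2 (hv.trans hw)
      rw [mul_comm, ← eq_div_iff (pow_ne_zero 3 hE)] at h
      rw [Fin.sum_univ_eight, h]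
      simp only [Matrix.cons_val, Fin.coe_ofNat_eq_mod]
      norm_num only
      ring)
  rw [hw] at key
  refine ⟨?_, ?_, ?_, ?_, ?_, ?_, ?_, ?_⟩
  on_goal 1 => convert! key 0 using 1
  on_goal 2 => convert! key 1 using 1
  on_goal 3 => convert! key 2 using 1
  on_goal 4 => convert! key 3 using 1
  on_goal 5 => convert! key 4 using 1
  on_goal 6 => convert! key 5 using 1
  on_goal 7 => convert! key 6 using 1
  on_goal 8 => convert! key 7 using 1
  all_goals simp only [Matrix.cons_val]
  on_goal 8 =>
    have e3 : phi q ^ 4 = phi q ^ 2 * (phi (q ^ 2) ^ 2 + 4 * q * psi (q ^ 4) ^ 2) := by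
      rw [← e1]
      ring
    have e4 : psi (q ^ 2) ^ 4 = psi (q ^ 2) ^ 2 * (phi (q ^ 2) * psi (q ^ 4)) := by
      rw [← e2]
      ring
    rw [e3, e4]
    field_simp
    ring
  all_goals ring
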